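/- Consider the model of the AODV routing protocol in the process algebra AWN (Algebra for Wireless Networks). A network consists of finitely many nodes with pairwise distinct addresses $ip$; each node runs the main AODV process in parallel with a message queue (which is always ready to receive messages and hands them to the main process in order), and its transmission range, a set of addresses, may change at any time. The main process of a node maintains, among others, its own sequence number $\mathtt{sn}\in\mathbb N$ and a set $\mathtt{rreqs}$ of pairs (originator address, route request identifier) of the route requests it has already handled. For a state $N$ of the network, $\xi_N^{ip}$ denotes the current valuation of the variables of the main process of node $ip$. In an initial state every node has $\mathtt{sn}=1$, an empty routing table, $\mathtt{rreqs}=\emptyset$, no queued data packets, and an empty message queue; transmission ranges are arbitrary. A state is reachable if it can be reached from an initial state by finitely many transitions. To initiate a route request, node $ip$ increments $\mathtt{sn}$, takes as new identifier $rreqid$ one more than the maximum of all $n$ with $(ip,n)\in\mathtt{rreqs}$ (the maximum of $\emptyset$ being $0$), adds $(ip,rreqid)$ to $\mathtt{rreqs}$, and broadcasts a RREQ message that contains, among other components, $rreqid$, the originator address $oip=ip$ and the originator sequence number $osn=\mathtt{sn}$. A node that receives a RREQ message with a pair $(oip,rreqid)$ not in its set $\mathtt{rreqs}$ adds the pair to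 this set and, unless it answers the request itself, forwards the message, i.e. broadcasts a RREQ message with the same $rreqid$, $oip$ and $osn$. On a finite path of transitions that starts in an initial state, a *route request* is an equivalence class of transmissions of RREQ messages, for the least equivalence relation under which a forwarded RREQ message belongs to the same route request as the message being forwarded (a message with exactly the content that is being handled, transmitted earlier on the path to the forwarding node, among others). **Proposition.** (a) A node's sequence number is greater than its last used RREQ id: in every reachable state $N$ and for every node $ip$ of $N$, the set $\{n\mid (ip,n)\in\xi_N^{ip}(\mathtt{rreqs})\}$ is bounded, and $$\xi_N^{ip}(\mathtt{sn})>\max\{n\mid (ip,n)\in\xi_N^{ip}(\mathtt{rreqs})\},$$ where the maximum of the empty set is $0$. (b) A route request is uniquely determined by the pair $(oip,osn)$ of originator address and originator sequence number: on every finite path that starts in an initial state, two transmissions of RREQ messages belong to the same route request if and only if the two messages carry the same pair $(oip,osn)$. In particular, different initiations of route requests on the path carry different pairs $(oip,osn)$. -/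

import Mathlib

/-!
The routing protocol AODV as a process in AWN, the Algebra for Wireless Networks.

`IP` is the type of IP addresses (node identifiers), `DATA` the type of application layer data.
Sequence numbers and route request identifiers are natural numbers.
-/

namespace AODV

/-! ### Data structure -/

/-- Sequence-number-status flag: known or unknown. -/
inductive SqnStatus | kno | unk
  deriving DecidableEq

/-- Validity of a route. -/
inductive RouteFlag | val | inval
  deriving DecidableEq

/-- Request-required flag of a data queue. -/
inductive ReqFlag | req | noReq

/-- A routing table entry, without its first component, the destination. -/
structure Entry (IP : Type) where
  dsn : ℕ
  dsk : SqnStatus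
  flag : RouteFlag
  hops : ℕ
  nhip : IP
  pre : Set IP

/-- Routing tables: sets of entries with at most one entry for each destination, that is,
partial functions from destinations to entries. -/
abbrev RT (IP : Type) := IP → Option (Entry IP)

/-- Sets of pairs `(rip, rsn)` with at most one pair for each `rip`. -/
abbrev Dests (IP : Type) := IP → Option ℕ

/-- Stores of queued data packets: at most one flag and queue for each destination. -/
abbrev Store (IP DATA : Type) := IP → Option (ReqFlag × List DATA)

/-- Messages. -/
inductive Msg (IP DATA : Type)
  | newpkt (d : DATA) (dip : IP)
  | pkt (d : DATA) (dip sip : IP)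
  | rreq (hops rreqid : ℕ) (dip : IP) (dsn : ℕ) (dsk : SqnStatus) (oip : IP) (osn : ℕ) (sip : IP)
  | rrep (hops : ℕ) (dip : IP) (dsn : ℕ) (oip sip : IP)
  | rerr (dests : Dests IP) (sip : IP)

section Functions

variable {IP DATA : Type}

/-- Increment of a sequence number; `0` stands for the unknown sequence number. -/
def inc (sn : ℕ) : ℕ := if sn ≠ 0 then sn + 1 else sn

def sqn (rt : RT IP) (dip : IP) : ℕ :=
  match rt dip with
  | some r => r.dsn
  | none => 0

def sqnf (rt : RT IP) (dip : IP) : SqnStatus :=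
  match rt dip with
  | some r => r.dsk
  | none => .unk

def dhops (rt : RT IP) (dip : IP) : Option ℕ := (rt dip).map Entry.hops

def nhop (rt : RT IP) (dip : IP) : Option IP := (rt dip).map Entry.nhip

def precs (rt : RT IP) (dip : IP) : Option (Set IP) := (rt dip).map Entry.pre

/-- Destinations of valid routes. -/
def vD (rt : RT IP) : Set IP := {dip | ∃ r, rt dip = some r ∧ r.flag = .val}

/-- Destinations of invalid routes. -/
def iD (rt : RT IP) : Set IP := {dip | ∃ r, rt dip = some r ∧ r.flag = .inval}

def addpre (r : Entry IP) (npre : Set IP) : Entry IP := { r with pre := r.pre ∪ npre }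

open Classical in
noncomputable def addpreRT (rt : RT IP) (dip : IP) (npre : Set IP) : Option (RT IP) :=
  (rt dip).map fun r => Function.update rt dip (some (addpre r npre))

/-- Result of updating the current entry `s` (if any) for a destination with the new entry `r`. -/
def updateEntry (s : Option (Entry IP)) (r : Entry IP) : Entry IP :=
  match s with
  | none => r
  | some s =>
    let nr := addpre r s.pre
    if s.dsn < r.dsn then nr
    else if s.dsn = r.dsn ∧ s.hops > r.hops then nr
    else if s.dsn = r.dsn ∧ s.flag = .inval then nr
    else if r.dsk = .unk then { nr with dsn := s.dsn }
    else addpre s r.pre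

open Classical in
/-- `update rt dip r` updates the routing table `rt` with the entry `r` for destination `dip`; it
is defined only for the entries described in the first line. -/
noncomputable def update (rt : RT IP) (dip : IP) (r : Entry IP) : Option (RT IP) :=
  if r.flag = .val ∧ (r.dsn = 0 ↔ r.dsk = .unk) ∧ (r.dsk = .unk → r.hops = 1) then
    some (Function.update rt dip (some (updateEntry (rt dip) r)))
  else none

def invalidate (rt : RT IP) (dests : Dests IP) : RT IP := fun rip =>
  match rt rip, dests rip with
  | some r, some rsn => some { r with dsn := rsn, flag := .inval }
  | o, _ => o

/-- The last route request identifier used by `ip`: the maximum of all `n` with `(ip, n)` in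
`rreqs`, where the maximum of the empty set is `0`. -/
noncomputable def lastRreqid (rreqs : Set (IP × ℕ)) (ip : IP) : ℕ :=
  sSup {n | (ip, n) ∈ rreqs}

noncomputable def nrreqid (rreqs : Set (IP × ℕ)) (ip : IP) : ℕ := lastRreqid rreqs ip + 1

/-- The queue of packets for `dip`. -/
def selQueue (store : Store IP DATA) (dip : IP) : List DATA :=
  match store dip with
  | some (_, q) => q
  | none => []

/-- Destinations with queued data packets. -/
def qD (store : Store IP DATA) : Set IP := {dip | store dip ≠ none}

/-- The request-required flag for `dip`. -/
def selFlag (store : Store IP DATA) (dip : IP) : Option ReqFlag := (store dip).map Prod.fst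

open Classical in
noncomputable def add (d : DATA) (dip : IP) (store : Store IP DATA) : Store IP DATA :=
  match store dip with
  | none => Function.update store dip (some (.req, [d]))
  | some (p, q) => Function.update store dip (some (p, q ++ [d]))

open Classical in
noncomputable def drop (dip : IP) (store : Store IP DATA) : Option (Store IP DATA) :=
  match store dip with
  | none => none
  | some (_, []) => none
  | some (_, [_]) => some (Function.update store dip none)
  | some (p, _ :: q) => some (Function.update store dip (some (p, q)))

open Classical in
noncomputable def unsetRRF (store : Store IP DATA) (dip : IP) : Store IP DATA :=
  Function.update store dip ((store dip).map fun e => (.noReq, e.2))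

def setRRF (store : Store IP DATA) (dests : Dests IP) : Store IP DATA := fun dip =>
  match store dip, dests dip with
  | some (_, q), some _ => some (.req, q)
  | o, _ => o

open Classical in
/-- `{(rip, inc (sqn rt rip)) | rip ∈ vD rt ∧ nhop rt rip = nhop rt dst}`, where an equation with
an undefined side is false. -/
noncomputable def brokenDests (rt : RT IP) (dst : IP) : Dests IP := fun rip =>
  if rip ∈ vD rt ∧ ∃ h, nhop rt rip = some h ∧ nhop rt dst = some h then
    some (inc (sqn rt rip))
  else none

open Classical in
/-- `{(rip, rsn) | (rip, rsn) ∈ dests ∧ rip ∈ vD rt ∧ nhop rt rip = sip ∧ sqn rt rip < rsn}`. -/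
noncomputable def affectedDests (rt : RT IP) (dests : Dests IP) (sip : IP) : Dests IP := fun rip =>
  (dests rip).bind fun rsn =>
    if rip ∈ vD rt ∧ nhop rt rip = some sip ∧ sqn rt rip < rsn then some rsn else none

/-- The union of all `precs rt rip` with `(rip, *) ∈ dests`. -/
def allPrecs (rt : RT IP) (dests : Dests IP) : Set IP :=
  {p | ∃ rip rsn s, dests rip = some rsn ∧ precs rt rip = some s ∧ p ∈ s}

open Classical in
/-- `{(rip, rsn) | (rip, rsn) ∈ dests ∧ precs rt rip ≠ ∅}`. -/
noncomputable def destsWithPrecs (rt : RT IP) (dests : Dests IP) : Dests IP := fun rip =>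
  if ∃ s, precs rt rip = some s ∧ s ≠ ∅ then dests rip else none

open Classical in
/-- `{(dip, rsn)}`. -/
noncomputable def singleDest (dip : IP) (rsn : ℕ) : Dests IP :=
  Function.update (fun _ => none) dip (some rsn)

end Functions

/-! ### Variables, valuations, data expressions and formulas -/

/-- The data variables. -/
inductive Var
  | ip | sn | rt | rreqs | store | msg | data | dip | oip | hops | rreqid | dsn | dsk | osn | sip
  | dests | pre | msgs
  deriving DecidableEq

/-- The type of the values of a variable. -/
@[reducible] def Ty (IP DATA : Type) : Var → Type
  | .ip | .dip | .oip | .sip => IP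
  | .sn | .hops | .rreqid | .dsn | .osn => ℕ
  | .rt => RT IP
  | .rreqs => Set (IP × ℕ)
  | .store => Store IP DATA
  | .msg => Msg IP DATA
  | .data => DATA
  | .dsk => SqnStatus
  | .dests => Dests IP
  | .pre => Set IP
  | .msgs => List (Msg IP DATA)

/-- Valuations: partial assignments of values to the variables. -/
abbrev Valuation (IP DATA : Type) := (v : Var) → Option (Ty IP DATA v)

/-- Data expressions, which may be undefined under a valuation. -/
abbrev Expr (IP DATA α : Type) := Valuation IP DATA → Option α

/-- Data formulas: the variables that occur free, and the valuations that satisfy the formula. -/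
structure Formula (IP DATA : Type) where
  fv : List Var
  holds : Valuation IP DATA → Prop

section Valuations

variable {IP DATA : Type}

/-- `ξ[v := x]`. -/
def Valuation.set (ξ : Valuation IP DATA) (v : Var) (x : Ty IP DATA v) : Valuation IP DATA :=
  Function.update ξ v (some x)

/-- `ζ` extends `ξ` by values for exactly those free variables of `φ` on which `ξ` is undefined,
such that `φ` holds under `ζ`. -/
def Formula.Extends (φ : Formula IP DATA) (ξ ζ : Valuation IP DATA) : Prop :=
  (∀ v, ξ v ≠ none → ζ v = ξ v) ∧ (∀ v ∈ φ.fv, ζ v ≠ none) ∧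
    (∀ v, ξ v = none → v ∉ φ.fv → ζ v = none) ∧ φ.holds ζ

end Valuations

/-! ### Sequential processes -/

/-- The process names. -/
inductive PName
  | aodv | newpkt | pkt | rreq | rrep | rerr | qmsg

/-- Sequential process expressions. In `call X args` each argument comes with the formal parameter
of `X` that it instantiates; `receive p` binds the variable `msg` in `p`. -/
inductive Seq (IP DATA : Type) : Type
  | call (X : PName) (args : List (Σ v : Var, Expr IP DATA (Ty IP DATA v)))
  | guard (φ : Formula IP DATA) (p : Seq IP DATA)
  | assign (v : Var) (e : Expr IP DATA (Ty IP DATA v)) (p : Seq IP DATA)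
  | choice (p q : Seq IP DATA)
  | broadcast (ms : Expr IP DATA (Msg IP DATA)) (p : Seq IP DATA)
  | groupcast (ds : Expr IP DATA (Set IP)) (ms : Expr IP DATA (Msg IP DATA)) (p : Seq IP DATA)
  | unicast (dst : Expr IP DATA IP) (ms : Expr IP DATA (Msg IP DATA)) (p q : Seq IP DATA)
  | send (ms : Expr IP DATA (Msg IP DATA)) (p : Seq IP DATA)
  | deliver (d : Expr IP DATA DATA) (p : Seq IP DATA)
  | receive (p : Seq IP DATA)

/-- `p + q`. -/
local infixr:65 " ⊹ " => Seq.choice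

/-! ### The processes of AODV -/

section Processes

variable (IP DATA : Type)

/-- `X(v₁, …, vₙ)`, where the `vᵢ` are the formal parameters of `X`. -/
def callVars (X : PName) (vs : List Var) : Seq IP DATA :=
  .call X (vs.map fun v => ⟨v, fun ξ => ξ v⟩)

/-- The variables maintained by all processes but `QMSG`. -/
def mainVars : List Var := [.ip, .sn, .rt, .rreqs, .store]

/-- `AODV(ip, sn, rt, rreqs, store)`. -/
def callAodv : Seq IP DATA := callVars IP DATA .aodv mainVars

/-- `QMSG(msgs)`. -/
def callQmsg : Seq IP DATA := callVars IP DATA .qmsg [.msgs]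

/-- `[v = ip] p` for a variable `v` of type `IP`, given as an expression `e`. -/
def ifEqIp (v : Var) (e : Expr IP DATA IP) (p : Seq IP DATA) : Seq IP DATA :=
  .guard ⟨[v, .ip], fun ξ => ∃ x, e ξ = some x ∧ ξ .ip = some x⟩ p

/-- `[v ≠ ip] p` for a variable `v` of type `IP`, given as an expression `e`. -/
def ifNeIp (v : Var) (e : Expr IP DATA IP) (p : Seq IP DATA) : Seq IP DATA :=
  .guard ⟨[v, .ip], fun ξ => ∃ x y, e ξ = some x ∧ ξ .ip = some y ∧ x ≠ y⟩ p

/-- Invalidation of the routes to `dests`, followed by an error message to the precursors. -/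
noncomputable def invalidateAndReport : Seq IP DATA :=
  .assign .rt (fun ξ => do return invalidate (← ξ .rt) (← ξ .dests)) <|
  .assign .store (fun ξ => do return setRRF (← ξ .store) (← ξ .dests)) <|
  .assign .pre (fun ξ => do return allPrecs (← ξ .rt) (← ξ .dests)) <|
  .assign .dests (fun ξ => do return destsWithPrecs (← ξ .rt) (← ξ .dests)) <|
  .groupcast (fun ξ => ξ .pre) (fun ξ => do return .rerr (← ξ .dests) (← ξ .ip)) <|
  callAodv IP DATA

/-- Reaction to a failed unicast to the next hop on the route to `dst`. -/
noncomputable def linkBreak (dst : Expr IP DATA IP) : Seq IP DATA :=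
  .assign .dests (fun ξ => do return brokenDests (← ξ .rt) (← dst ξ)) <|
  invalidateAndReport IP DATA

/-- `[[rt := update(rt, (sip, 0, unk, val, 1, sip, ∅))]] p`. -/
noncomputable def updateSender (p : Seq IP DATA) : Seq IP DATA :=
  .assign .rt (fun ξ => do
    let rt ← ξ .rt
    let sip ← ξ .sip
    update rt sip ⟨0, .unk, .val, 1, sip, ∅⟩) p

/-- The broadcast by which a node initiates a new route request. -/
def newRreq : Seq IP DATA :=
  .broadcast (fun ξ => do
    let rt ← ξ .rt
    let dip ← ξ .dip
    let ip ← ξ .ip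
    return .rreq 0 (← ξ .rreqid) dip (sqn rt dip) (sqnf rt dip) ip (← ξ .sn) ip) <|
  callAodv IP DATA

/-- The basic routine. -/
noncomputable def bodyAodv : Seq IP DATA :=
  .receive (
    .guard ⟨[.msg, .data, .dip], fun ξ => ∃ d dip, ξ .data = some d ∧ ξ .dip = some dip ∧
        ξ .msg = some (.newpkt d dip)⟩
      (callVars IP DATA .newpkt (.data :: .dip :: mainVars))
    ⊹ .guard ⟨[.msg, .data, .dip, .oip], fun ξ => ∃ d dip oip, ξ .data = some d ∧
        ξ .dip = some dip ∧ ξ .oip = some oip ∧ ξ .msg = some (.pkt d dip oip)⟩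
      (callVars IP DATA .pkt (.data :: .dip :: .oip :: mainVars))
    ⊹ .guard ⟨[.msg, .hops, .rreqid, .dip, .dsn, .dsk, .oip, .osn, .sip], fun ξ =>
        ∃ hops rreqid dip dsn dsk oip osn sip, ξ .hops = some hops ∧ ξ .rreqid = some rreqid ∧
          ξ .dip = some dip ∧ ξ .dsn = some dsn ∧ ξ .dsk = some dsk ∧ ξ .oip = some oip ∧
          ξ .osn = some osn ∧ ξ .sip = some sip ∧
          ξ .msg = some (.rreq hops rreqid dip dsn dsk oip osn sip)⟩
      (updateSender IP DATA <| callVars IP DATA .rreq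
        ([.hops, .rreqid, .dip, .dsn, .dsk, .oip, .osn, .sip] ++ mainVars))
    ⊹ .guard ⟨[.msg, .hops, .dip, .dsn, .oip, .sip], fun ξ => ∃ hops dip dsn oip sip,
        ξ .hops = some hops ∧ ξ .dip = some dip ∧ ξ .dsn = some dsn ∧ ξ .oip = some oip ∧
        ξ .sip = some sip ∧ ξ .msg = some (.rrep hops dip dsn oip sip)⟩
      (updateSender IP DATA <| callVars IP DATA .rrep
        ([.hops, .dip, .dsn, .oip, .sip] ++ mainVars))
    ⊹ .guard ⟨[.msg, .dests, .sip], fun ξ => ∃ dests sip, ξ .dests = some dests ∧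
        ξ .sip = some sip ∧ ξ .msg = some (.rerr dests sip)⟩
      (updateSender IP DATA <| callVars IP DATA .rerr ([.dests, .sip] ++ mainVars)))
  -- send a queued data packet if a valid route is known
  ⊹ .guard ⟨[.dip, .store, .rt], fun ξ => ∃ dip store rt, ξ .dip = some dip ∧
        ξ .store = some store ∧ ξ .rt = some rt ∧ dip ∈ qD store ∩ vD rt⟩
      (.assign .data (fun ξ => do (selQueue (← ξ .store) (← ξ .dip)).head?) <|
       .unicast (fun ξ => do nhop (← ξ .rt) (← ξ .dip))
         (fun ξ => do return .pkt (← ξ .data) (← ξ .dip) (← ξ .ip))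
         (.assign .store (fun ξ => do drop (← ξ .dip) (← ξ .store)) <| callAodv IP DATA)
         (linkBreak IP DATA fun ξ => ξ .dip))
  -- initiate a route discovery process
  ⊹ .guard ⟨[.dip, .store, .rt], fun ξ => ∃ dip store rt, ξ .dip = some dip ∧
        ξ .store = some store ∧ ξ .rt = some rt ∧ dip ∈ qD store \ vD rt ∧
        selFlag store dip = some .req⟩
      (.assign .store (fun ξ => do return unsetRRF (← ξ .store) (← ξ .dip)) <|
       .assign .sn (fun ξ => do return inc (← ξ .sn)) <|
       .assign .rreqid (fun ξ => do return nrreqid (← ξ .rreqs) (← ξ .ip)) <|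
       .assign .rreqs (fun ξ => do
         return (← ξ .rreqs) ∪ {((← ξ .ip), (← ξ .rreqid))}) <|
       newRreq IP DATA)

/-- Handling of a newly injected data packet. -/
noncomputable def bodyNewpkt : Seq IP DATA :=
  ifEqIp IP DATA .dip (fun ξ => ξ .dip) (.deliver (fun ξ => ξ .data) <| callAodv IP DATA)
  ⊹ ifNeIp IP DATA .dip (fun ξ => ξ .dip)
      (.assign .store (fun ξ => do return add (← ξ .data) (← ξ .dip) (← ξ .store)) <|
       callAodv IP DATA)

/-- Handling of a received data packet. -/
noncomputable def bodyPkt : Seq IP DATA :=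
  ifEqIp IP DATA .dip (fun ξ => ξ .dip) (.deliver (fun ξ => ξ .data) <| callAodv IP DATA)
  ⊹ ifNeIp IP DATA .dip (fun ξ => ξ .dip)
      (.guard ⟨[.dip, .rt], fun ξ => ∃ dip rt, ξ .dip = some dip ∧ ξ .rt = some rt ∧ dip ∈ vD rt⟩
        (.unicast (fun ξ => do nhop (← ξ .rt) (← ξ .dip))
          (fun ξ => do return .pkt (← ξ .data) (← ξ .dip) (← ξ .oip))
          (callAodv IP DATA)
          (linkBreak IP DATA fun ξ => ξ .dip))
      ⊹ .guard ⟨[.dip, .rt], fun ξ => ∃ dip rt, ξ .dip = some dip ∧ ξ .rt = some rt ∧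
          dip ∉ vD rt⟩
        (.guard ⟨[.dip, .rt], fun ξ => ∃ dip rt, ξ .dip = some dip ∧ ξ .rt = some rt ∧
            dip ∈ iD rt⟩
          (.groupcast (fun ξ => do precs (← ξ .rt) (← ξ .dip))
            (fun ξ => do
              let dip ← ξ .dip
              return .rerr (singleDest dip (sqn (← ξ .rt) dip)) (← ξ .ip)) <|
           callAodv IP DATA)
        ⊹ .guard ⟨[.dip, .rt], fun ξ => ∃ dip rt, ξ .dip = some dip ∧ ξ .rt = some rt ∧
            dip ∉ iD rt⟩
          (callAodv IP DATA)))

/-- The broadcast by which a node forwards a route request. -/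
def forwardRreq : Seq IP DATA :=
  .broadcast (fun ξ => do
    let rt ← ξ .rt
    let dip ← ξ .dip
    return .rreq ((← ξ .hops) + 1) (← ξ .rreqid) dip (max (sqn rt dip) (← ξ .dsn)) (← ξ .dsk)
      (← ξ .oip) (← ξ .osn) (← ξ .ip)) <|
  callAodv IP DATA

/-- Handling of a route request. -/
noncomputable def bodyRreq : Seq IP DATA :=
  .guard ⟨[.oip, .rreqid, .rreqs], fun ξ => ∃ oip rreqid rreqs, ξ .oip = some oip ∧
      ξ .rreqid = some rreqid ∧ ξ .rreqs = some rreqs ∧ (oip, rreqid) ∈ rreqs⟩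
    (callAodv IP DATA)
  ⊹ .guard ⟨[.oip, .rreqid, .rreqs], fun ξ => ∃ oip rreqid rreqs, ξ .oip = some oip ∧
      ξ .rreqid = some rreqid ∧ ξ .rreqs = some rreqs ∧ (oip, rreqid) ∉ rreqs⟩
    (.assign .rt (fun ξ => do
       update (← ξ .rt) (← ξ .oip) ⟨← ξ .osn, .kno, .val, (← ξ .hops) + 1, ← ξ .sip, ∅⟩) <|
     .assign .rreqs (fun ξ => do
       return (← ξ .rreqs) ∪ {((← ξ .oip), (← ξ .rreqid))}) <|
     -- this node is the destination
     ifEqIp IP DATA .dip (fun ξ => ξ .dip)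
       (.assign .sn (fun ξ => do return max (← ξ .sn) (← ξ .dsn)) <|
        .unicast (fun ξ => do nhop (← ξ .rt) (← ξ .oip))
          (fun ξ => do return .rrep 0 (← ξ .dip) (← ξ .sn) (← ξ .oip) (← ξ .ip))
          (callAodv IP DATA)
          (linkBreak IP DATA fun ξ => ξ .oip))
     ⊹ ifNeIp IP DATA .dip (fun ξ => ξ .dip)
       -- a fresh enough route to the destination is known
       (.guard ⟨[.dip, .rt, .dsn], fun ξ => ∃ dip rt dsn, ξ .dip = some dip ∧ ξ .rt = some rt ∧
            ξ .dsn = some dsn ∧ dip ∈ vD rt ∧ dsn ≤ sqn rt dip ∧ sqnf rt dip = .kno⟩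
         (.assign .rt (fun ξ => do addpreRT (← ξ .rt) (← ξ .dip) {← ξ .sip}) <|
          .assign .rt (fun ξ => do
            let rt ← ξ .rt
            addpreRT rt (← ξ .oip) {← nhop rt (← ξ .dip)}) <|
          .unicast (fun ξ => do nhop (← ξ .rt) (← ξ .oip))
            (fun ξ => do
              let rt ← ξ .rt
              let dip ← ξ .dip
              return .rrep (← dhops rt dip) dip (sqn rt dip) (← ξ .oip) (← ξ .ip))
            (callAodv IP DATA)
            (linkBreak IP DATA fun ξ => ξ .oip))
       ⊹ .guard ⟨[.dip, .rt, .dsn], fun ξ => ∃ dip rt dsn, ξ .dip = some dip ∧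
            ξ .rt = some rt ∧ ξ .dsn = some dsn ∧
            (dip ∉ vD rt ∨ sqn rt dip < dsn ∨ sqnf rt dip = .unk)⟩
         (forwardRreq IP DATA)))

/-- `update(rt, (dip, dsn, kno, val, hops + 1, sip, ∅))`. -/
noncomputable def rrepUpdate : Expr IP DATA (RT IP) := fun ξ => do
  update (← ξ .rt) (← ξ .dip) ⟨← ξ .dsn, .kno, .val, (← ξ .hops) + 1, ← ξ .sip, ∅⟩

/-- Handling of a route reply. -/
noncomputable def bodyRrep : Seq IP DATA :=
  .guard ⟨[.rt, .dip, .dsn, .hops, .sip], fun ξ => ∃ rt rt', ξ .rt = some rt ∧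
      rrepUpdate IP DATA ξ = some rt' ∧ rt ≠ rt'⟩
    (.assign .rt (rrepUpdate IP DATA) <|
     ifEqIp IP DATA .oip (fun ξ => ξ .oip) (callAodv IP DATA)
     ⊹ ifNeIp IP DATA .oip (fun ξ => ξ .oip)
       (.guard ⟨[.oip, .rt], fun ξ => ∃ oip rt, ξ .oip = some oip ∧ ξ .rt = some rt ∧
            oip ∈ vD rt⟩
         (.assign .rt (fun ξ => do
            let rt ← ξ .rt
            addpreRT rt (← ξ .dip) {← nhop rt (← ξ .oip)}) <|
          .assign .rt (fun ξ => do
            let rt ← ξ .rt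
            addpreRT rt (← nhop rt (← ξ .dip)) {← nhop rt (← ξ .oip)}) <|
          .unicast (fun ξ => do nhop (← ξ .rt) (← ξ .oip))
            (fun ξ => do
              return .rrep ((← ξ .hops) + 1) (← ξ .dip) (← ξ .dsn) (← ξ .oip) (← ξ .ip))
            (callAodv IP DATA)
            (linkBreak IP DATA fun ξ => ξ .oip))
       ⊹ .guard ⟨[.oip, .rt], fun ξ => ∃ oip rt, ξ .oip = some oip ∧ ξ .rt = some rt ∧
            oip ∉ vD rt⟩
         (callAodv IP DATA)))
  ⊹ .guard ⟨[.rt, .dip, .dsn, .hops, .sip], fun ξ => ∃ rt, ξ .rt = some rt ∧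
      rrepUpdate IP DATA ξ = some rt⟩
    (callAodv IP DATA)

/-- Handling of a route error message. -/
noncomputable def bodyRerr : Seq IP DATA :=
  .assign .dests (fun ξ => do return affectedDests (← ξ .rt) (← ξ .dests) (← ξ .sip)) <|
  invalidateAndReport IP DATA

/-- `receive(msg) . QMSG(append(msg, msgs))`. -/
def enqueue : Seq IP DATA :=
  .receive (.call .qmsg [⟨.msgs, fun ξ => do return (← ξ .msgs) ++ [← ξ .msg]⟩])

/-- The message queue. -/
def bodyQmsg : Seq IP DATA :=
  enqueue IP DATA
  ⊹ .guard ⟨[.msgs], fun ξ => ∃ ms, ξ .msgs = some ms ∧ ms ≠ []⟩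
      (.send (fun ξ => do (← ξ .msgs).head?)
        (.call .qmsg [⟨.msgs, fun ξ => do (← ξ .msgs).tail?⟩])
      ⊹ enqueue IP DATA)

/-- The defining equations of the process names. -/
noncomputable def body : PName → Seq IP DATA
  | .aodv => bodyAodv IP DATA
  | .newpkt => bodyNewpkt IP DATA
  | .pkt => bodyPkt IP DATA
  | .rreq => bodyRreq IP DATA
  | .rrep => bodyRrep IP DATA
  | .rerr => bodyRerr IP DATA
  | .qmsg => bodyQmsg IP DATA

end Processes

/-! ### Operational semantics -/

/-- The actions of sequential and parallel processes; `failedUnicast` is `¬unicast`. -/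
inductive Act (IP DATA : Type)
  | broadcast (m : Msg IP DATA)
  | groupcast (D : Set IP) (m : Msg IP DATA)
  | unicast (dip : IP) (m : Msg IP DATA)
  | failedUnicast (dip : IP) (m : Msg IP DATA)
  | send (m : Msg IP DATA)
  | deliver (d : DATA)
  | receive (m : Msg IP DATA)
  | tau

section Semantics

variable {IP DATA : Type}

/-- `∅[vᵢ := ξ(eᵢ)]`, undefined if one of the `ξ(eᵢ)` is. -/
def bindArgs (ξ : Valuation IP DATA) :
    List (Σ v : Var, Expr IP DATA (Ty IP DATA v)) → Option (Valuation IP DATA)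
  | [] => some fun _ => none
  | ⟨v, e⟩ :: args => do
    let x ← e ξ
    let ζ ← bindArgs ξ args
    return ζ.set v x

/-- Transitions of sequential processes. -/
inductive SeqTrans : Valuation IP DATA → Seq IP DATA → Act IP DATA →
    Valuation IP DATA → Seq IP DATA → Prop
  | broadcast {ξ ms m p} : ms ξ = some m → SeqTrans ξ (.broadcast ms p) (.broadcast m) ξ p
  | groupcast {ξ ds D ms m p} : ds ξ = some D → ms ξ = some m →
      SeqTrans ξ (.groupcast ds ms p) (.groupcast D m) ξ p
  | unicast {ξ dst dip ms m p q} : dst ξ = some dip → ms ξ = some m →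
      SeqTrans ξ (.unicast dst ms p q) (.unicast dip m) ξ p
  | failedUnicast {ξ dst dip ms m p q} : dst ξ = some dip → ms ξ = some m →
      SeqTrans ξ (.unicast dst ms p q) (.failedUnicast dip m) ξ q
  | send {ξ ms m p} : ms ξ = some m → SeqTrans ξ (.send ms p) (.send m) ξ p
  | deliver {ξ e d p} : e ξ = some d → SeqTrans ξ (.deliver e p) (.deliver d) ξ p
  | receive {ξ p} (m : Msg IP DATA) : SeqTrans ξ (.receive p) (.receive m) (ξ.set .msg m) p
  | assign {ξ v e x p} : e ξ = some x → SeqTrans ξ (.assign v e p) .tau (ξ.set v x) p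
  | call {ξ X args ξ' a ζ p'} : bindArgs ξ args = some ξ' →
      SeqTrans ξ' (body IP DATA X) a ζ p' → SeqTrans ξ (.call X args) a ζ p'
  | choiceLeft {ξ p q a ζ p'} : SeqTrans ξ p a ζ p' → SeqTrans ξ (.choice p q) a ζ p'
  | choiceRight {ξ p q a ζ q'} : SeqTrans ξ q a ζ q' → SeqTrans ξ (.choice p q) a ζ q'
  | guard {ξ φ p ζ} : φ.Extends ξ ζ → SeqTrans ξ (.guard φ p) .tau ζ p

end Semantics

/-- Parallel processes on one node; `par P Q` is the composition in which `Q` may send to `P`. -/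
inductive Par (IP DATA : Type) : Type
  | seq (ξ : Valuation IP DATA) (p : Seq IP DATA)
  | par (P Q : Par IP DATA)

/-- Transitions of parallel processes. -/
inductive ParTrans {IP DATA : Type} : Par IP DATA → Act IP DATA → Par IP DATA → Prop
  | seq {ξ p a ζ p'} : SeqTrans ξ p a ζ p' → ParTrans (.seq ξ p) a (.seq ζ p')
  | left {P Q a P'} : ParTrans P a P' → (∀ m, a ≠ .receive m) → ParTrans (.par P Q) a (.par P' Q)
  | right {P Q a Q'} : ParTrans Q a Q' → (∀ m, a ≠ .send m) → ParTrans (.par P Q) a (.par P Q')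
  | sync {P Q m P' Q'} : ParTrans P (.receive m) P' → ParTrans Q (.send m) Q' →
      ParTrans (.par P Q) .tau (.par P' Q')

/-- A node `ip : P : R` with address `ip`, process `P` and transmission range `R`. -/
structure Node (IP DATA : Type) where
  ip : IP
  proc : Par IP DATA
  range : Set IP

/-- Partial networks: parallel compositions of nodes. -/
inductive PNet (IP DATA : Type) : Type
  | node (n : Node IP DATA)
  | par (M N : PNet IP DATA)

/-- The labels of transitions of partial networks. `starcast s R m` is the action `R:*cast(m)`,
annotated with the address `s` of the node that performs it; `arrive H K m` is the arrival of `m`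
at the nodes in `H` and its non-arrival at the nodes in `K`. -/
inductive Label (IP DATA : Type)
  | starcast (s : IP) (R : Set IP) (m : Msg IP DATA)
  | arrive (H K : Set IP) (m : Msg IP DATA)
  | connect (ip ip' : IP)
  | disconnect (ip ip' : IP)
  | deliver (ip : IP) (d : DATA)
  | tau

/-- Transitions of partial networks. -/
inductive PNetTrans {IP DATA : Type} : PNet IP DATA → Label IP DATA → PNet IP DATA → Prop
  | broadcast {ip P R m P'} : ParTrans P (.broadcast m) P' →
      PNetTrans (.node ⟨ip, P, R⟩) (.starcast ip R m) (.node ⟨ip, P', R⟩)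
  | groupcast {ip P R D m P'} : ParTrans P (.groupcast D m) P' →
      PNetTrans (.node ⟨ip, P, R⟩) (.starcast ip (R ∩ D) m) (.node ⟨ip, P', R⟩)
  | unicast {ip P R dip m P'} : ParTrans P (.unicast dip m) P' → dip ∈ R →
      PNetTrans (.node ⟨ip, P, R⟩) (.starcast ip {dip} m) (.node ⟨ip, P', R⟩)
  | failedUnicast {ip P R dip m P'} : ParTrans P (.failedUnicast dip m) P' → dip ∉ R →
      PNetTrans (.node ⟨ip, P, R⟩) .tau (.node ⟨ip, P', R⟩)
  | deliver {ip P R d P'} : ParTrans P (.deliver d) P' →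
      PNetTrans (.node ⟨ip, P, R⟩) (.deliver ip d) (.node ⟨ip, P', R⟩)
  | receive {ip P R m P'} : ParTrans P (.receive m) P' →
      PNetTrans (.node ⟨ip, P, R⟩) (.arrive {ip} ∅ m) (.node ⟨ip, P', R⟩)
  | tau {ip P R P'} : ParTrans P .tau P' →
      PNetTrans (.node ⟨ip, P, R⟩) .tau (.node ⟨ip, P', R⟩)
  | miss {ip P R} (m : Msg IP DATA) :
      PNetTrans (.node ⟨ip, P, R⟩) (.arrive ∅ {ip} m) (.node ⟨ip, P, R⟩)
  | connectFst {ip P R} (ip' : IP) :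
      PNetTrans (.node ⟨ip, P, R⟩) (.connect ip ip') (.node ⟨ip, P, R ∪ {ip'}⟩)
  | disconnectFst {ip P R} (ip' : IP) :
      PNetTrans (.node ⟨ip, P, R⟩) (.disconnect ip ip') (.node ⟨ip, P, R \ {ip'}⟩)
  | connectSnd {ip P R} (ip' : IP) :
      PNetTrans (.node ⟨ip, P, R⟩) (.connect ip' ip) (.node ⟨ip, P, R ∪ {ip'}⟩)
  | disconnectSnd {ip P R} (ip' : IP) :
      PNetTrans (.node ⟨ip, P, R⟩) (.disconnect ip' ip) (.node ⟨ip, P, R \ {ip'}⟩)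
  | connectOther {ip P R ip' ip''} : ip ≠ ip' → ip ≠ ip'' →
      PNetTrans (.node ⟨ip, P, R⟩) (.connect ip' ip'') (.node ⟨ip, P, R⟩)
  | disconnectOther {ip P R ip' ip''} : ip ≠ ip' → ip ≠ ip'' →
      PNetTrans (.node ⟨ip, P, R⟩) (.disconnect ip' ip'') (.node ⟨ip, P, R⟩)
  | castLeft {M N s R H K m M' N'} : PNetTrans M (.starcast s R m) M' →
      PNetTrans N (.arrive H K m) N' → H ⊆ R → K ∩ R = ∅ →
      PNetTrans (.par M N) (.starcast s R m) (.par M' N')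
  | castRight {M N s R H K m M' N'} : PNetTrans M (.arrive H K m) M' →
      PNetTrans N (.starcast s R m) N' → H ⊆ R → K ∩ R = ∅ →
      PNetTrans (.par M N) (.starcast s R m) (.par M' N')
  | arrive {M N H K H' K' m M' N'} : PNetTrans M (.arrive H K m) M' →
      PNetTrans N (.arrive H' K' m) N' →
      PNetTrans (.par M N) (.arrive (H ∪ H') (K ∪ K') m) (.par M' N')
  | deliverLeft {M N ip d M'} : PNetTrans M (.deliver ip d) M' →
      PNetTrans (.par M N) (.deliver ip d) (.par M' N)
  | deliverRight {M N ip d N'} : PNetTrans N (.deliver ip d) N' →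
      PNetTrans (.par M N) (.deliver ip d) (.par M N')
  | tauLeft {M N M'} : PNetTrans M .tau M' → PNetTrans (.par M N) .tau (.par M' N)
  | tauRight {M N N'} : PNetTrans N .tau N' → PNetTrans (.par M N) .tau (.par M N')
  | connect {M N ip ip' M' N'} : PNetTrans M (.connect ip ip') M' →
      PNetTrans N (.connect ip ip') N' → PNetTrans (.par M N) (.connect ip ip') (.par M' N')
  | disconnect {M N ip ip' M' N'} : PNetTrans M (.disconnect ip ip') M' →
      PNetTrans N (.disconnect ip ip') N' →
      PNetTrans (.par M N) (.disconnect ip ip') (.par M' N')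

/-- Complete networks `[M]`: encapsulated partial networks. -/
structure Net (IP DATA : Type) where
  inner : PNet IP DATA

/-- The labels of transitions of complete networks. -/
inductive NetLabel (IP DATA : Type)
  | connect (ip ip' : IP)
  | disconnect (ip ip' : IP)
  | newpkt (ip : IP) (d : DATA) (dip : IP)
  | deliver (ip : IP) (d : DATA)
  | tau

/-- `Encap a ℓ`: a transition of `M` labelled `a` yields a transition of `[M]` labelled `ℓ`. -/
inductive Encap {IP DATA : Type} : Label IP DATA → NetLabel IP DATA → Prop
  | connect (ip ip' : IP) : Encap (.connect ip ip') (.connect ip ip')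
  | disconnect (ip ip' : IP) : Encap (.disconnect ip ip') (.disconnect ip ip')
  | starcast (s : IP) (R : Set IP) (m : Msg IP DATA) : Encap (.starcast s R m) .tau
  | tau : Encap .tau .tau
  | deliver (ip : IP) (d : DATA) : Encap (.deliver ip d) (.deliver ip d)
  | newpkt (ip : IP) (K : Set IP) (d : DATA) (dip : IP) :
      Encap (.arrive {ip} K (.newpkt d dip)) (.newpkt ip d dip)

section Networks

variable {IP DATA : Type}

/-- `NetStep N a N'`: a transition between complete networks that stems from a transition labelled
`a` between the partial networks inside. -/
def NetStep (N : Net IP DATA) (a : Label IP DATA) (N' : Net IP DATA) : Prop :=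
  PNetTrans N.inner a N'.inner ∧ ∃ ℓ, Encap a ℓ

/-- Transitions of complete networks. -/
def NetTrans (N : Net IP DATA) (ℓ : NetLabel IP DATA) (N' : Net IP DATA) : Prop :=
  ∃ a, PNetTrans N.inner a N'.inner ∧ Encap a ℓ

/-- The node expressions of a partial network. -/
def PNet.nodes : PNet IP DATA → List (Node IP DATA)
  | .node n => [n]
  | .par M N => M.nodes ++ N.nodes

/-- The node expressions of a network. -/
def Net.nodes (N : Net IP DATA) : List (Node IP DATA) := N.inner.nodes

/-- The main sequential process of a node together with its valuation: the left component of the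
parallel process that runs on the node, the right one being the message queue. -/
def Node.main (n : Node IP DATA) : Option (Valuation IP DATA × Seq IP DATA) :=
  match n.proc with
  | .par (.seq ξ p) _ => some (ξ, p)
  | _ => none

/-- A node in its initial state, with arbitrary transmission range. -/
def Node.IsInitial (n : Node IP DATA) : Prop :=
  ∃ ξ ζ : Valuation IP DATA,
    n.proc = .par (.seq ξ (callAodv IP DATA)) (.seq ζ (callQmsg IP DATA)) ∧
    ξ .ip = some n.ip ∧ ξ .sn = some 1 ∧ ξ .rt = some (fun _ => none) ∧ ξ .rreqs = some ∅ ∧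
    ξ .store = some (fun _ => none) ∧ ζ .msgs = some []

/-- Initial states: each node is in its initial state, and the addresses are distinct. -/
def Net.IsInitial (N : Net IP DATA) : Prop :=
  (N.nodes.map Node.ip).Nodup ∧ ∀ n ∈ N.nodes, n.IsInitial

/-- The reachable states. -/
def Net.Reachable (N : Net IP DATA) : Prop :=
  ∃ N₀ : Net IP DATA, N₀.IsInitial ∧ Relation.ReflTransGen (fun A B => ∃ ℓ, NetTrans A ℓ B) N₀ N

end Networks

/-! ### Route requests -/

/-- Finite paths in the transition system that start in an initial state. For each transition the
label of the underlying transition between partial networks is recorded; the values of `state` and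
`label` beyond the end of the path are irrelevant. -/
structure Run (IP DATA : Type) where
  length : ℕ
  state : ℕ → Net IP DATA
  label : ℕ → Label IP DATA
  initial : (state 0).IsInitial
  step : ∀ i < length, NetStep (state i) (label i) (state (i + 1))

section RouteRequests

variable {IP DATA : Type}

/-- The `i`-th transition is the casting of a RREQ message with originator address `oip` and
originator sequence number `osn`. -/
def Run.CastsRreq (r : Run IP DATA) (i : ℕ) (oip : IP) (osn : ℕ) : Prop :=
  i < r.length ∧ ∃ s R hops rreqid dip dsn dsk sip,
    r.label i = .starcast s R (.rreq hops rreqid dip dsn dsk oip osn sip)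

/-- The `i`-th transition is a cast by a node whose main process is about to execute `p` under the
valuation `ξ`. -/
def Run.CastsFrom (r : Run IP DATA) (i : ℕ) (s : IP) (ξ : Valuation IP DATA) (p : Seq IP DATA) :
    Prop :=
  i < r.length ∧ (∃ R m, r.label i = .starcast s R m) ∧
    ∃ n ∈ (r.state i).nodes, n.ip = s ∧ n.main = some (ξ, p)

/-- The `i`-th transition marks the initiation of a new route request. -/
def Run.Initiates (r : Run IP DATA) (i : ℕ) : Prop :=
  ∃ s ξ, r.CastsFrom i s ξ (newRreq IP DATA)

/-- The RREQ message handled by a process `RREQ(hops, rreqid, dip, dsn, dsk, oip, osn, sip, …)`. -/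
def handledRreq (ξ : Valuation IP DATA) : Option (Msg IP DATA) := do
  return .rreq (← ξ .hops) (← ξ .rreqid) (← ξ .dip) (← ξ .dsn) (← ξ .dsk) (← ξ .oip) (← ξ .osn)
    (← ξ .sip)

/-- The `j`-th transition is the forwarding of the RREQ message that was cast, to the forwarding
node among others, in the `i`-th transition. -/
def Run.Forwards (r : Run IP DATA) (i j : ℕ) : Prop :=
  i < j ∧ ∃ s ξ m, r.CastsFrom j s ξ (forwardRreq IP DATA) ∧ handledRreq ξ = some m ∧
    ∃ s' R', r.label i = .starcast s' R' m ∧ s ∈ R'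

/-- Two RREQ transmissions belong to the same route request. A route request is an equivalence
class of transmissions of RREQ messages, for the least equivalence relation under which a forwarded
RREQ message belongs to the same route request as the message being forwarded. -/
def Run.SameRouteRequest (r : Run IP DATA) : ℕ → ℕ → Prop := Relation.EqvGen r.Forwards

end RouteRequests

end AODV

/-! Attach to each node `ip` a ghost number `u ip`: the originator sequence number of its latest
initiation, or `0` before the first. A local and a global fact are proved together by induction
along the transitions. Locally, `u ≤ sn`, `1 ≤ sn`, and every `k` with `(ip, k) ∈ rreqs` is below
`sn`. Globally, every RREQ message cast so far satisfies `rid < osn` and `osn ≤ u oip`.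

An initiation raises `sn` by one and uses the last identifier plus one, which is at most the old
`sn`; its `osn` is the new `sn`, exceeds `u`, and becomes the new `u`. Answering as destination can
only raise `sn`. Recording the pair of a received request affects the local fact only when the
node's own request comes back, and then `rid < osn ≤ u ≤ sn` by the global fact. Forwarding copies
`rid`, `oip` and `osn`, so the global fact persists. This proves (a).

For (b), forwarding preserves `(oip, osn)`, so each class carries a single pair
(`Run.SameRouteRequest.castsRreq`). Conversely, a forwarded message was cast earlier to the
forwarding node, so descent in time reaches an initiation with the same pair
(`Run.CastsRreq.exists_initiates`). An initiation has a larger `osn` than all earlier casts with its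
originator, so the pair determines it (`Run.Initiates.eq`).

The local part is a verification of the program text. `Safe` is defined by recursion on the process
and stops at calls, where it demands `Pre`; `Safe.body` shows that every body is safe under its
`Pre`. `QSafe` does the same for the queue, which passes on only messages with a given property. The
parameter `A` stands for the messages already cast to the node; it supplies the earlier transmission
behind each forwarding. `Safe` forbids a broadcast directly under a choice, so that a broadcasting
process is syntactically `newRreq` or `forwardRreq`, as `Run.CastsFrom` requires. `Net.Inv.cast` and
`Net.Inv.step` lift this to networks. -/

namespace AODV

/-! ### Invariants of the main process and of the message queue -/

section Invariant

variable {IP DATA : Type}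

/-- The conditions on the valuation of the main process of node `ip` that hold in all its states,
where `u` is the originator sequence number of the last route request initiated by `ip`. -/
def Base (ip : IP) (u : ℕ) (ξ : Valuation IP DATA) : Prop :=
  ∃ (sn : ℕ) (rreqs : Set (IP × ℕ)), ξ .ip = some ip ∧ ξ .sn = some sn ∧ ξ .rreqs = some rreqs ∧
    u ≤ sn ∧ 1 ≤ sn ∧ ∀ k, (ip, k) ∈ rreqs → k < sn

/-- A message that may be received by `ip`: if it is a route request then it is in `A`, and if it
stems from `ip` then it is not newer than the last route request initiated by `ip`. -/
def Trusted (ip : IP) (A : Set (Msg IP DATA)) (u : ℕ) (m : Msg IP DATA) : Prop :=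
  ∀ hops rid dip dsn dsk oip osn sip, m = .rreq hops rid dip dsn dsk oip osn sip →
    m ∈ A ∧ (oip = ip → rid < osn ∧ osn ≤ u)

/-- The message handled under `ξ` is a trusted route request. -/
def Handling (ip : IP) (A : Set (Msg IP DATA)) (u : ℕ) (ξ : Valuation IP DATA) : Prop :=
  ∃ m, handledRreq ξ = some m ∧ Trusted ip A u m

/-- The preconditions of the process names. -/
def Pre (ip : IP) (A : Set (Msg IP DATA)) (u : ℕ) (ξ : Valuation IP DATA) : PName → Prop
  | .qmsg => False
  | .rreq => Base ip u ξ ∧ Handling ip A u ξ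
  | _ => Base ip u ξ

def Msg.IsRreq (m : Msg IP DATA) : Prop :=
  ∃ hops rid dip dsn dsk oip osn sip, m = .rreq hops rid dip dsn dsk oip osn sip

/-- A process that may start with a broadcast, apart from calls. -/
def Seq.StartsBroadcast : Seq IP DATA → Prop
  | .broadcast _ _ => True
  | .choice p q => p.StartsBroadcast ∨ q.StartsBroadcast
  | _ => False

/-- The broadcast of `m` by `p` initiates a route request that is newer than `u`. -/
def InitCast (ip : IP) (u osn : ℕ) (p : Seq IP DATA) (m : Msg IP DATA) : Prop :=
  p = newRreq IP DATA ∧ u < osn ∧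
    ∃ rid dip dsn dsk, rid < osn ∧ m = .rreq 0 rid dip dsn dsk ip osn ip

/-- The broadcast of `m` by `p` under `ξ` forwards a route request in `A`. -/
def ForwardCast (ip : IP) (A : Set (Msg IP DATA)) (u : ℕ) (ξ : Valuation IP DATA)
    (p : Seq IP DATA) (m : Msg IP DATA) : Prop :=
  p = forwardRreq IP DATA ∧ ∃ hops rid dip dsn dsk oip osn sip dsn',
    handledRreq ξ = some (.rreq hops rid dip dsn dsk oip osn sip) ∧
    Trusted ip A u (.rreq hops rid dip dsn dsk oip osn sip) ∧
    m = .rreq (hops + 1) rid dip dsn' dsk oip osn ip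

/-- The invariant of the main process of node `ip`, a weakest precondition. -/
def Safe (ip : IP) (A : Set (Msg IP DATA)) (u : ℕ) (ξ : Valuation IP DATA) :
    Seq IP DATA → Prop
  | .call X args => Base ip u ξ ∧ ∀ ξ', bindArgs ξ args = some ξ' → Pre ip A u ξ' X
  | .guard φ p => Base ip u ξ ∧ ∀ ζ, φ.Extends ξ ζ → Safe ip A u ζ p
  | .assign v e p => Base ip u ξ ∧ ∀ x, e ξ = some x → Safe ip A u (ξ.set v x) p
  | .choice p q => ¬ (Seq.choice p q).StartsBroadcast ∧ Safe ip A u ξ p ∧ Safe ip A u ξ q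
  | .broadcast ms p => Base ip u ξ ∧ ∀ m, ms ξ = some m →
      (∃ osn, InitCast ip u osn (.broadcast ms p) m ∧ Safe ip A osn ξ p) ∨
      (ForwardCast ip A u ξ (.broadcast ms p) m ∧ Safe ip A u ξ p)
  | .groupcast _ ms p => (∀ m, ms ξ = some m → ¬ m.IsRreq) ∧ Safe ip A u ξ p
  | .unicast _ ms p q => (∀ m, ms ξ = some m → ¬ m.IsRreq) ∧ Safe ip A u ξ p ∧ Safe ip A u ξ q
  | .send _ p => Safe ip A u ξ p
  | .deliver _ p => Safe ip A u ξ p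
  | .receive p => Base ip u ξ ∧
      ∀ A', A ⊆ A' → ∀ m, Trusted ip A' u m → Safe ip A' u (ξ.set .msg m) p

/-- The invariant of the message queue, all of whose messages satisfy `K`. -/
def QSafe (K : Msg IP DATA → Prop) (ξ : Valuation IP DATA) : Seq IP DATA → Prop
  | .call X args => X = .qmsg ∧ ∀ ξ', bindArgs ξ args = some ξ' →
      ∃ ms, ξ' .msgs = some ms ∧ ∀ m ∈ ms, K m
  | .guard φ p => ∀ ζ, φ.Extends ξ ζ → QSafe K ζ p
  | .choice p q => QSafe K ξ p ∧ QSafe K ξ q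
  | .send ms p => ∀ m, ms ξ = some m → K m ∧ QSafe K ξ p
  | .receive p => ∀ K' : Msg IP DATA → Prop, (∀ m, K m → K' m) →
      ∀ m, K' m → QSafe K' (ξ.set .msg m) p
  | _ => False

variable {ip : IP} {A A' : Set (Msg IP DATA)} {u u' : ℕ} {ξ ζ : Valuation IP DATA}

theorem Trusted.mono {m : Msg IP DATA} (h : Trusted ip A u m) (hA : A ⊆ A') (hu : u ≤ u') :
    Trusted ip A' u' m := by
  intro hops rid dip dsn dsk oip osn sip hm
  obtain ⟨h1, h2⟩ := h _ _ _ _ _ _ _ _ hm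
  exact ⟨hA h1, fun ho => ⟨(h2 ho).1, (h2 ho).2.trans hu⟩⟩

theorem Handling.mono (h : Handling ip A u ξ) (hA : A ⊆ A') : Handling ip A' u ξ := by
  obtain ⟨m, h1, h2⟩ := h
  exact ⟨m, h1, h2.mono hA le_rfl⟩

theorem Pre.mono {X : PName} (h : Pre ip A u ξ X) (hA : A ⊆ A') : Pre ip A' u ξ X := by
  cases X <;> first | exact h | exact ⟨h.1, h.2.mono hA⟩

theorem ForwardCast.mono {p : Seq IP DATA} {m : Msg IP DATA} (h : ForwardCast ip A u ξ p m)
    (hA : A ⊆ A') : ForwardCast ip A' u ξ p m := by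
  obtain ⟨h0, hops, rid, dip, dsn, dsk, oip, osn, sip, dsn', h1, h2, h3⟩ := h
  exact ⟨h0, hops, rid, dip, dsn, dsk, oip, osn, sip, dsn', h1, h2.mono hA le_rfl, h3⟩

/-- The history of casts grows while the process waits; the clause for `receive` already quantifies
over all larger histories. There is no such monotonicity in `u`, since `Base` demands `u ≤ sn`. -/
theorem Safe.mono {p : Seq IP DATA} (h : Safe ip A u ξ p) (hA : A ⊆ A') :
    Safe ip A' u ξ p := by
  induction p generalizing u ξ A with
  | call X args => exact ⟨h.1, fun ξ' hξ => (h.2 ξ' hξ).mono hA⟩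
  | guard φ p ih => exact ⟨h.1, fun ζ hζ => ih (h.2 ζ hζ) hA⟩
  | assign v e p ih => exact ⟨h.1, fun x hx => ih (h.2 x hx) hA⟩
  | choice p q ihp ihq => exact ⟨h.1, ihp h.2.1 hA, ihq h.2.2 hA⟩
  | broadcast ms p ih =>
    refine ⟨h.1, fun m hm => ?_⟩
    obtain ⟨osn, h1, h2⟩ | ⟨h1, h2⟩ := h.2 m hm
    · exact .inl ⟨osn, h1, ih h2 hA⟩
    · exact .inr ⟨h1.mono hA, ih h2 hA⟩
  | groupcast ds ms p ih => exact ⟨h.1, ih h.2 hA⟩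
  | unicast dst ms p q ihp ihq => exact ⟨h.1, ihp h.2.1 hA, ihq h.2.2 hA⟩
  | send ms p ih => exact ih (A := A) h hA
  | deliver d p ih => exact ih (A := A) h hA
  | receive p ih => exact ⟨h.1, fun B hB m hm => h.2 B (hA.trans hB) m hm⟩

/-- Applied with `K` the trust predicate: queued messages stay trusted when the history grows and
when the node's own `u` is raised by an initiation. -/
theorem QSafe.mono {K K' : Msg IP DATA → Prop} {p : Seq IP DATA} (h : QSafe K ξ p)
    (hK : ∀ m, K m → K' m) : QSafe K' ξ p := by
  induction p generalizing ξ with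
  | call X args =>
    refine ⟨h.1, fun ξ' hξ => ?_⟩
    obtain ⟨ms, h1, h2⟩ := h.2 ξ' hξ
    exact ⟨ms, h1, fun m hm => hK m (h2 m hm)⟩
  | guard φ p ih => exact fun ζ hζ => ih (h ζ hζ)
  | choice p q ihp ihq => exact ⟨ihp h.1, ihq h.2⟩
  | send ms p ih => exact fun m hm => ⟨hK m (h m hm).1, ih (h m hm).2⟩
  | receive p ih => exact fun B hB m hm => h B (fun m hm => hB m (hK m hm)) m hm
  | _ => exact h.elim

theorem Safe.base {p : Seq IP DATA} (h : Safe ip A u ξ p) : Base ip u ξ := by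
  induction p with
  | choice p q ihp _ => exact ihp h.2.1
  | groupcast ds ms p ih => exact ih h.2
  | unicast dst ms p q ihp _ => exact ihp h.2.1
  | send ms p ih => exact ih h
  | deliver d p ih => exact ih h
  | _ => exact h.1

/-! ### Valuations -/

theorem Valuation.set_of_ne {v w : Var} {x : Ty IP DATA v} (h : w ≠ v) : ξ.set v x w = ξ w :=
  Function.update_of_ne h _ _

theorem Valuation.set_self {v : Var} {x : Ty IP DATA v} : ξ.set v x v = some x :=
  Function.update_self _ _ _

theorem Formula.Extends.eq_some {φ : Formula IP DATA} (h : φ.Extends ξ ζ) {v : Var}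
    {x : Ty IP DATA v} (hx : ξ v = some x) : ζ v = some x := by
  rw [h.1 v (by simp [hx]), hx]

theorem bindArgs_map {vs : List Var}
    (h : bindArgs ξ (vs.map fun v => ⟨v, fun ξ => ξ v⟩) = some ζ) {v : Var} (hv : v ∈ vs) :
    ζ v = ξ v := by
  induction vs generalizing ζ with
  | nil => simp at hv
  | cons w vs ih =>
    simp only [List.map_cons, bindArgs, Option.bind_eq_bind, Option.bind_eq_some_iff,
      Option.pure_def, Option.some.injEq] at h
    obtain ⟨x, hx, ζ', hζ', rfl⟩ := h
    by_cases hvw : v = w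
    · subst hvw
      rw [Valuation.set_self, hx]
    · rw [Valuation.set_of_ne hvw]
      exact ih hζ' (by simpa [hvw] using hv)

theorem Base.of_eq (h : Base ip u ξ) (h1 : ζ .ip = ξ .ip) (h2 : ζ .sn = ξ .sn)
    (h3 : ζ .rreqs = ξ .rreqs) : Base ip u ζ := by
  unfold Base at *
  rwa [h1, h2, h3]

theorem Base.set (h : Base ip u ξ) {v : Var} {x : Ty IP DATA v} (h1 : Var.ip ≠ v)
    (h2 : Var.sn ≠ v) (h3 : Var.rreqs ≠ v) : Base ip u (ξ.set v x) :=
  h.of_eq (Valuation.set_of_ne h1) (Valuation.set_of_ne h2) (Valuation.set_of_ne h3)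

theorem Base.extends {φ : Formula IP DATA} (h : Base ip u ξ) (hζ : φ.Extends ξ ζ) :
    Base ip u ζ := by
  obtain ⟨sn, rreqs, h1, h2, h3, h4⟩ := h
  exact ⟨sn, rreqs, hζ.eq_some h1, hζ.eq_some h2, hζ.eq_some h3, h4⟩

/-- Definedness of the handled message forces all eight variables to be defined, so later guards
cannot change them. -/
theorem handledRreq_eq_some {m : Msg IP DATA} : handledRreq ξ = some m ↔
    ∃ hops rid dip dsn dsk oip osn sip, ξ .hops = some hops ∧ ξ .rreqid = some rid ∧
      ξ .dip = some dip ∧ ξ .dsn = some dsn ∧ ξ .dsk = some dsk ∧ ξ .oip = some oip ∧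
      ξ .osn = some osn ∧ ξ .sip = some sip ∧ m = .rreq hops rid dip dsn dsk oip osn sip := by
  simp only [handledRreq, Option.bind_eq_bind, Option.bind_eq_some_iff, Option.pure_def,
    Option.some.injEq]
  grind

/-- The variables that hold the components of a route request. -/
def rreqVars : List Var := [.hops, .rreqid, .dip, .dsn, .dsk, .oip, .osn, .sip]

theorem Handling.of_eq (h : Handling ip A u ξ) (h1 : ∀ v ∈ rreqVars, ζ v = ξ v) :
    Handling ip A u ζ := by
  simp only [rreqVars, List.mem_cons, List.not_mem_nil, or_false, forall_eq_or_imp,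
    forall_eq] at h1
  simpa only [Handling, handledRreq, h1] using h

theorem Handling.set (h : Handling ip A u ξ) {v : Var} {x : Ty IP DATA v} (hv : v ∉ rreqVars) :
    Handling ip A u (ξ.set v x) :=
  h.of_eq fun _ hw => Valuation.set_of_ne fun e => hv (e ▸ hw)

theorem Handling.extends {φ : Formula IP DATA} (h : Handling ip A u ξ) (hζ : φ.Extends ξ ζ) :
    Handling ip A u ζ := by
  obtain ⟨m, h1, h2⟩ := h
  refine ⟨m, ?_, h2⟩
  rw [handledRreq_eq_some] at h1 ⊢
  obtain ⟨hops, rid, dip, dsn, dsk, oip, osn, sip, a1, a2, a3, a4, a5, a6, a7, a8, hm⟩ := h1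
  exact ⟨hops, rid, dip, dsn, dsk, oip, osn, sip, hζ.eq_some a1, hζ.eq_some a2, hζ.eq_some a3,
    hζ.eq_some a4, hζ.eq_some a5, hζ.eq_some a6, hζ.eq_some a7, hζ.eq_some a8, hm⟩

/-! ### Verification of the processes -/

theorem Safe.guard {φ : Formula IP DATA} {p : Seq IP DATA} (h : Base ip u ξ)
    (hp : ∀ ζ, φ.Extends ξ ζ → Base ip u ζ → Safe ip A u ζ p) : Safe ip A u ξ (.guard φ p) :=
  ⟨h, fun ζ hζ => hp ζ hζ (h.extends hζ)⟩

theorem Safe.assign {v : Var} {e : Expr IP DATA (Ty IP DATA v)} {p : Seq IP DATA}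
    (h : Base ip u ξ) (hv : v ∉ [Var.ip, Var.sn, Var.rreqs])
    (hp : ∀ x, e ξ = some x → Base ip u (ξ.set v x) → Safe ip A u (ξ.set v x) p) :
    Safe ip A u ξ (.assign v e p) := by
  refine ⟨h, fun x hx => hp x hx ?_⟩
  simp only [List.mem_cons, List.not_mem_nil, or_false, not_or] at hv
  exact h.set (Ne.symm hv.1) (Ne.symm hv.2.1) (Ne.symm hv.2.2)

theorem Safe.callVars {X : PName} {vs : List Var} (h : Base ip u ξ)
    (hvs : ∀ v ∈ [Var.ip, Var.sn, Var.rreqs], v ∈ vs) (hX : X ≠ .qmsg)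
    (hH : X = .rreq → Handling ip A u ξ ∧ ∀ v ∈ rreqVars, v ∈ vs) :
    Safe ip A u ξ (callVars IP DATA X vs) := by
  refine ⟨h, fun ξ' hξ => ?_⟩
  simp only [List.mem_cons, List.not_mem_nil, or_false, forall_eq_or_imp, forall_eq] at hvs
  have hb : Base ip u ξ' := h.of_eq (bindArgs_map hξ hvs.1) (bindArgs_map hξ hvs.2.1)
    (bindArgs_map hξ hvs.2.2)
  cases X with
  | qmsg => exact hX rfl
  | rreq => exact ⟨hb, (hH rfl).1.of_eq fun v hv => bindArgs_map hξ ((hH rfl).2 v hv)⟩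
  | _ => exact hb

theorem Safe.callAodv (h : Base ip u ξ) : Safe ip A u ξ (callAodv IP DATA) :=
  Safe.callVars h (by decide) (by simp) (by simp)

theorem Safe.invalidateAndReport (h : Base ip u ξ) :
    Safe ip A u ξ (invalidateAndReport IP DATA) := by
  refine Safe.assign h (by decide) fun _ _ h => ?_
  refine Safe.assign h (by decide) fun _ _ h => ?_
  refine Safe.assign h (by decide) fun _ _ h => ?_
  refine Safe.assign h (by decide) fun _ _ h => ?_
  refine ⟨?_, Safe.callAodv h⟩
  rintro m hm ⟨_, _, _, _, _, _, _, _, rfl⟩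
  simp [Option.bind_eq_some_iff] at hm

theorem Safe.linkBreak {dst : Expr IP DATA IP} (h : Base ip u ξ) :
    Safe ip A u ξ (linkBreak IP DATA dst) :=
  Safe.assign h (by decide) fun _ _ h => Safe.invalidateAndReport h

theorem Safe.updateSender {p : Seq IP DATA} (h : Base ip u ξ)
    (hp : ∀ x, Base ip u (ξ.set .rt x) → Safe ip A u (ξ.set .rt x) p) :
    Safe ip A u ξ (updateSender IP DATA p) :=
  Safe.assign h (by decide) fun x _ h => hp x h

theorem Safe.unicast {dst : Expr IP DATA IP} {ms : Expr IP DATA (Msg IP DATA)}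
    {e : Expr IP DATA IP} (h : Base ip u ξ) (hm : ∀ m, ms ξ = some m → ¬ m.IsRreq) :
    Safe ip A u ξ (.unicast dst ms (AODV.callAodv IP DATA) (AODV.linkBreak IP DATA e)) :=
  ⟨hm, Safe.callAodv h, Safe.linkBreak h⟩

/-- All identifiers are at most `sn - 1`, and `csSup_le'` covers the empty set too, whose supremum
in `ℕ` is `0`. The hypothesis `1 ≤ sn` makes the inequality strict. -/
theorem lastRreqid_lt {rreqs : Set (IP × ℕ)} {sn : ℕ} (h1 : 1 ≤ sn)
    (h : ∀ k, (ip, k) ∈ rreqs → k < sn) : lastRreqid rreqs ip < sn := by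
  have : lastRreqid rreqs ip ≤ sn - 1 :=
    csSup_le' fun k hk => Nat.le_sub_one_of_lt (h k hk)
  omega

theorem Safe.bodyAodv (h : Base ip u ξ) : Safe ip A u ξ (bodyAodv IP DATA) := by
  refine ⟨by simp [Seq.StartsBroadcast], ⟨h, fun A' _ m hm => ?_⟩, ?_⟩
  · have h : Base ip u (ξ.set .msg m) := h.set (by decide) (by decide) (by decide)
    have hmsg : ξ.set .msg m .msg = some m := Valuation.set_self
    refine ⟨by simp [Seq.StartsBroadcast], ?_, by simp [Seq.StartsBroadcast], ?_,
      by simp [Seq.StartsBroadcast], ?_, by simp [Seq.StartsBroadcast], ?_, ?_⟩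
    · exact Safe.guard h fun _ _ h => Safe.callVars h (by decide) (by simp) (by simp)
    · exact Safe.guard h fun _ _ h => Safe.callVars h (by decide) (by simp) (by simp)
    · refine Safe.guard h fun ζ hζ h => Safe.updateSender h fun x h =>
        Safe.callVars h (by decide) (by simp) fun _ => ⟨Handling.set ?_ (by decide), by decide⟩
      obtain ⟨hops, rid, dip, dsn, dsk, oip, osn, sip, a1, a2, a3, a4, a5, a6, a7, a8, a9⟩ :=
        hζ.2.2.2
      -- The guard cannot reassign the defined variable `msg`, so the eight variables hold the
      -- components of the trusted message `m`.
      rw [hζ.eq_some hmsg] at a9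
      exact ⟨m, handledRreq_eq_some.2 ⟨hops, rid, dip, dsn, dsk, oip, osn, sip, a1, a2, a3, a4,
        a5, a6, a7, a8, Option.some.inj a9⟩, hm⟩
    · exact Safe.guard h fun _ _ h => Safe.updateSender h fun _ h =>
        Safe.callVars h (by decide) (by simp) (by simp)
    · exact Safe.guard h fun _ _ h => Safe.updateSender h fun _ h =>
        Safe.callVars h (by decide) (by simp) (by simp)
  · refine ⟨by simp [Seq.StartsBroadcast], Safe.guard h fun ζ _ h => ?_,
      Safe.guard h fun ζ _ h => ?_⟩
    · refine Safe.assign h (by decide) fun _ _ h => ⟨?_, ?_, Safe.linkBreak h⟩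
      · rintro m hm ⟨_, _, _, _, _, _, _, _, rfl⟩
        simp [Option.bind_eq_some_iff] at hm
      · exact Safe.assign h (by decide) fun _ _ h => Safe.callAodv h
    · refine Safe.assign h (by decide) fun x _ h => ?_
      generalize ζ.set .store x = ξ at h
      refine ⟨h, fun (sn' : ℕ) hsn' => ?_⟩
      obtain ⟨sn, rreqs, h1, h2, h3, h4, h5, h6⟩ := h
      have hlast := lastRreqid_lt h5 h6
      -- `inc` fixes `0`, so this needs `1 ≤ sn`.
      have hs : sn' = sn + 1 := by
        have : sn ≠ 0 := by omega
        simpa [h2, inc, this, eq_comm] using hsn'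
      refine Safe.assign ⟨sn', rreqs, ?_, Valuation.set_self, ?_, by omega, by omega,
        fun k hk => (h6 k hk).trans (by omega)⟩ (by decide) fun (rid : ℕ) hrid h => ?_
      · rw [Valuation.set_of_ne (by decide), h1]
      · rw [Valuation.set_of_ne (by decide), h3]
      refine ⟨h, fun rreqs' hrreqs' => ?_⟩
      have e1 : ((ξ.set .sn sn').set .rreqid rid) .ip = some ip := by
        rw [Valuation.set_of_ne (by decide), Valuation.set_of_ne (by decide), h1]
      have e2 : ((ξ.set .sn sn').set .rreqid rid) .sn = some sn' := by
        rw [Valuation.set_of_ne (by decide), Valuation.set_self]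
      have e3 : ((ξ.set .sn sn').set .rreqid rid) .rreqs = some rreqs := by
        rw [Valuation.set_of_ne (by decide), Valuation.set_of_ne (by decide), h3]
      have e4 : ((ξ.set .sn sn').set .rreqid rid) .rreqid = some rid :=
        Valuation.set_self
      have e5 : rid = lastRreqid rreqs ip + 1 := by
        rw [Valuation.set_of_ne (by decide), Valuation.set_of_ne (by decide)] at hrid
        simpa [h1, h3, nrreqid, eq_comm] using hrid
      generalize (ξ.set .sn sn').set .rreqid rid = ξ at *
      obtain rfl : rreqs' = rreqs ∪ {(ip, rid)} := by
        simpa [e1, e3, e4, eq_comm] using hrreqs'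
      -- Needed twice: with the old `u` before the broadcast and with `sn'`, the new ghost value,
      -- after it. The added identifier is at most `sn`, hence below `sn' = sn + 1`.
      have hb : ∀ v ≤ sn', Base ip v (ξ.set .rreqs (rreqs ∪ {(ip, rid)})) := by
        intro v hv
        refine ⟨sn', _, ?_, ?_, Valuation.set_self, hv, by omega, ?_⟩
        · rw [Valuation.set_of_ne (by decide), e1]
        · rw [Valuation.set_of_ne (by decide), e2]
        · rintro k (hk | hk)
          · exact (h6 k hk).trans (by omega)
          · have : k = rid := by simpa using hk
            omega
      refine ⟨hb u (by omega), fun m hm => .inl ⟨sn', ⟨rfl, by omega, ?_⟩,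
        Safe.callAodv (hb _ le_rfl)⟩⟩
      simp only [Option.bind_eq_bind, Option.bind_eq_some_iff, Option.pure_def,
        Option.some.injEq] at hm
      obtain ⟨rt, _, dip, _, ip', hip, rid', hrid', sn'', hsn, rfl⟩ := hm
      rw [Valuation.set_of_ne (by decide), e1] at hip
      rw [Valuation.set_of_ne (by decide), e4] at hrid'
      rw [Valuation.set_of_ne (by decide), e2] at hsn
      cases hip
      cases hrid'
      cases hsn
      exact ⟨_, _, _, _, by omega, rfl⟩

end Invariant

section Invariant

variable {IP DATA : Type} {ip : IP} {A : Set (Msg IP DATA)} {u : ℕ} {ξ : Valuation IP DATA}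

theorem Safe.choice {p q : Seq IP DATA} (hp : ¬ p.StartsBroadcast) (hq : ¬ q.StartsBroadcast)
    (h1 : Safe ip A u ξ p) (h2 : Safe ip A u ξ q) : Safe ip A u ξ (.choice p q) :=
  ⟨fun h => h.elim hp hq, h1, h2⟩

theorem Safe.bodyNewpkt (h : Base ip u ξ) : Safe ip A u ξ (bodyNewpkt IP DATA) := by
  refine Safe.choice id id (Safe.guard h fun _ _ h => Safe.callAodv h)
    (Safe.guard h fun _ _ h => Safe.assign h (by decide) fun _ _ h => Safe.callAodv h)

theorem Safe.bodyPkt (h : Base ip u ξ) : Safe ip A u ξ (bodyPkt IP DATA) := by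
  refine Safe.choice id id (Safe.guard h fun _ _ h => Safe.callAodv h)
    (Safe.guard h fun _ _ h => Safe.choice id id (Safe.guard h fun _ _ h => Safe.unicast h ?_)
      (Safe.guard h fun _ _ h => Safe.choice id id
        (Safe.guard h fun _ _ h => ⟨?_, Safe.callAodv h⟩)
        (Safe.guard h fun _ _ h => Safe.callAodv h)))
  all_goals
    rintro m hm ⟨_, _, _, _, _, _, _, _, rfl⟩
    simp [Option.bind_eq_some_iff] at hm

theorem Safe.bodyRerr (h : Base ip u ξ) : Safe ip A u ξ (bodyRerr IP DATA) :=
  Safe.assign h (by decide) fun _ _ h => Safe.invalidateAndReport h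

theorem Safe.bodyRrep (h : Base ip u ξ) : Safe ip A u ξ (bodyRrep IP DATA) := by
  refine Safe.choice id id
    (Safe.guard h fun _ _ h => Safe.assign h (by decide) fun _ _ h =>
      Safe.choice id id
      (Safe.guard h fun _ _ h => Safe.callAodv h)
      (Safe.guard h fun _ _ h => Safe.choice id id
        (Safe.guard h fun _ _ h => Safe.assign h (by decide) fun _ _ h =>
          Safe.assign h (by decide) fun _ _ h => Safe.unicast h ?_)
        (Safe.guard h fun _ _ h => Safe.callAodv h)))
    (Safe.guard h fun _ _ h => Safe.callAodv h)
  rintro m hm ⟨_, _, _, _, _, _, _, _, rfl⟩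
  simp [Option.bind_eq_some_iff] at hm

/-- The broadcast copies `rreqid`, `oip` and `osn` from the handled message; the recomputed
destination sequence number is left unspecified. -/
theorem Safe.forwardRreq (h : Base ip u ξ) (hH : Handling ip A u ξ) :
    Safe ip A u ξ (forwardRreq IP DATA) := by
  refine ⟨h, fun m hm => .inr ⟨⟨rfl, ?_⟩, Safe.callAodv h⟩⟩
  obtain ⟨m', h1, h2⟩ := hH
  obtain ⟨hops, rid, dip, dsn, dsk, oip, osn, sip, a1, a2, a3, a4, a5, a6, a7, a8, rfl⟩ :=
    handledRreq_eq_some.1 h1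
  obtain ⟨sn, rreqs, b1, b2⟩ := h
  simp only [Option.bind_eq_bind, Option.bind_eq_some_iff, Option.pure_def,
    Option.some.injEq, a1, a2, a3, a4, a5, a6, a7, b1, exists_eq_left'] at hm
  obtain ⟨rt, _, rfl⟩ := hm
  exact ⟨hops, rid, dip, dsn, dsk, oip, osn, sip, _, h1, h2, rfl⟩

theorem Safe.bodyRreq (h : Base ip u ξ) (hH : Handling ip A u ξ) :
    Safe ip A u ξ (bodyRreq IP DATA) := by
  refine Safe.choice id id (Safe.guard h fun _ _ h => Safe.callAodv h)
    (Safe.guard h fun ζ hζ h => ?_)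
  replace hH := hH.extends hζ
  refine Safe.assign h (by decide) fun x _ h => ?_
  replace hH := hH.set (v := .rt) (x := x) (by decide)
  generalize ζ.set .rt x = ξ at h hH
  refine ⟨h, fun rreqs' hr => ?_⟩
  replace h : Base ip u (ξ.set .rreqs rreqs') := by
    obtain ⟨m, h1, h2⟩ := hH
    obtain ⟨hops, rid, dip, dsn, dsk, oip, osn, sip, -, a2, -, -, -, a6, -, -, rfl⟩ :=
      handledRreq_eq_some.1 h1
    obtain ⟨sn, rreqs, b1, b2, b3, b4, b5, b6⟩ := h
    obtain rfl : rreqs' = rreqs ∪ {(oip, rid)} := by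
      simpa [a2, a6, b3, eq_comm] using hr
    refine ⟨sn, _, ?_, ?_, Valuation.set_self, b4, b5, ?_⟩
    · rw [Valuation.set_of_ne (by decide), b1]
    · rw [Valuation.set_of_ne (by decide), b2]
    · rintro k (hk | hk)
      · exact b6 k hk
      -- The node's own request has come back. Trust gives `rid < osn ≤ u`, and `u ≤ sn`.
      · obtain ⟨rfl, rfl⟩ : ip = oip ∧ k = rid := by simpa using hk
        have := (h2 _ _ _ _ _ _ _ _ rfl).2 rfl
        omega
  replace hH := hH.set (v := .rreqs) (x := rreqs') (by decide)
  generalize ξ.set .rreqs rreqs' = ξ at h hH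
  refine Safe.choice id id (Safe.guard h fun ζ _ h => ?_)
    (Safe.guard h fun ζ hζ h => Safe.choice id id
      (Safe.guard h fun _ _ h => Safe.assign h (by decide) fun _ _ h =>
          Safe.assign h (by decide) fun _ _ h => Safe.unicast h ?_)
      (Safe.guard h fun ζ' hζ' h => Safe.forwardRreq h ((hH.extends hζ).extends hζ')))
  · refine ⟨h, fun (sn' : ℕ) hsn => ?_⟩
    refine Safe.unicast ?_ ?_
    · obtain ⟨sn, rreqs, b1, b2, b3, b4, b5, b6⟩ := h
      simp only [Option.bind_eq_bind, Option.bind_eq_some_iff, Option.pure_def,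
        Option.some.injEq, b2, exists_eq_left'] at hsn
      obtain ⟨dsn, _, hd⟩ := hsn
      -- The destination adopts a maximum, so every bound by `sn` survives.
      have hle : sn ≤ sn' := hd ▸ le_max_left _ _
      refine ⟨sn', rreqs, ?_, Valuation.set_self, ?_, b4.trans hle, b5.trans hle,
        fun k hk => (b6 k hk).trans_le hle⟩
      · rw [Valuation.set_of_ne (by decide), b1]
      · rw [Valuation.set_of_ne (by decide), b3]
    · rintro m hm ⟨_, _, _, _, _, _, _, _, rfl⟩
      simp [Option.bind_eq_some_iff] at hm
  · rintro m hm ⟨_, _, _, _, _, _, _, _, rfl⟩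
    simp [Option.bind_eq_some_iff] at hm

/-- This closes the recursion through process names: `Safe` at a call asks only for `Pre`. -/
theorem Safe.body {X : PName} (h : Pre ip A u ξ X) : Safe ip A u ξ (body IP DATA X) := by
  cases X with
  | aodv => exact Safe.bodyAodv h
  | newpkt => exact Safe.bodyNewpkt h
  | pkt => exact Safe.bodyPkt h
  | rreq => exact Safe.bodyRreq h.1 h.2
  | rrep => exact Safe.bodyRrep h
  | rerr => exact Safe.bodyRerr h
  | qmsg => exact h.elim

theorem not_startsBroadcast_body (X : PName) : ¬ (body IP DATA X).StartsBroadcast := by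
  cases X <;> simp [body, Seq.StartsBroadcast, bodyAodv, bodyNewpkt, bodyPkt, bodyRreq, bodyRrep,
    bodyRerr, bodyQmsg, enqueue, ifEqIp, ifNeIp]

theorem QSafe.body_qmsg {K : Msg IP DATA → Prop} {ms : List (Msg IP DATA)}
    (h : ξ .msgs = some ms) (hK : ∀ m ∈ ms, K m) : QSafe K ξ (body IP DATA .qmsg) := by
  -- `enqueue` occurs twice, under `ξ` and under the valuation after the guard, hence the general
  -- `ζ`.
  have henq : ∀ {ζ : Valuation IP DATA}, ζ .msgs = some ms → QSafe K ζ (enqueue IP DATA) := by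
    refine fun {ζ} hζ K' hK' m hm => ⟨rfl, fun ξ' hξ' => ?_⟩
    have e1 : ζ.set .msg m .msgs = some ms := by rw [Valuation.set_of_ne (by decide), hζ]
    have e2 : ζ.set .msg m .msg = some m := Valuation.set_self
    simp only [bindArgs, e1, e2, Option.bind_eq_bind, Option.bind_some, Option.pure_def,
      Option.some.injEq] at hξ'
    subst hξ'
    refine ⟨ms ++ [m], Valuation.set_self, fun m' hm' => ?_⟩
    obtain hm' | rfl := by simpa using hm'
    · exact hK' _ (hK _ hm')
    · exact hm
  refine ⟨henq h, fun ζ hζ => ⟨fun m hm => ?_, henq (hζ.eq_some h)⟩⟩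
  have e := hζ.eq_some h
  have hm : ms.head? = some m := by simpa [e] using hm
  refine ⟨hK m (List.mem_of_mem_head? hm), rfl, fun ξ' hξ' => ?_⟩
  obtain ⟨l, rfl⟩ : ∃ l, ms = m :: l := by
    cases ms <;> simp_all
  simp only [bindArgs, e, Option.bind_eq_bind, Option.bind_some, Option.pure_def,
    Option.some.injEq, List.tail?_cons] at hξ'
  subst hξ'
  exact ⟨l, Valuation.set_self, fun m' hm' => hK _ (List.mem_cons_of_mem _ hm')⟩

/-! ### Preservation under transitions of sequential processes -/

/-- What the invariant guarantees about a transition that is not a broadcast. -/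
def Post (ip : IP) (A : Set (Msg IP DATA)) (u : ℕ) (ζ : Valuation IP DATA) (p : Seq IP DATA) :
    Act IP DATA → Prop
  | .broadcast _ => True
  | .groupcast _ m => ¬ m.IsRreq ∧ Safe ip A u ζ p
  | .unicast _ m => ¬ m.IsRreq ∧ Safe ip A u ζ p
  | .receive m => ∀ A', A ⊆ A' → Trusted ip A' u m → Safe ip A' u ζ p
  | _ => Safe ip A u ζ p

theorem Safe.post {ζ : Valuation IP DATA} {p p' : Seq IP DATA} {a : Act IP DATA}
    (ht : SeqTrans ξ p a ζ p') (h : Safe ip A u ξ p) : Post ip A u ζ p' a := by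
  induction ht with
  | broadcast _ => trivial
  | groupcast _ hm => exact ⟨h.1 _ hm, h.2⟩
  | unicast _ hm => exact ⟨h.1 _ hm, h.2.1⟩
  | failedUnicast _ _ => exact h.2.2
  | send _ => exact h
  | deliver _ => exact h
  | receive m => exact fun A' hA hm => h.2 A' hA m hm
  | assign hx => exact h.2 _ hx
  | call hb _ ih => exact ih (Safe.body (h.2 _ hb))
  | choiceLeft _ ih => exact ih h.2.1
  | choiceRight _ ih => exact ih h.2.2
  | guard hφ => exact h.2 _ hφ

/-- A call cannot hide an initial broadcast, because no body starts with one. -/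
theorem SeqTrans.startsBroadcast {ζ : Valuation IP DATA} {p p' : Seq IP DATA} {a : Act IP DATA}
    {m : Msg IP DATA} (ht : SeqTrans ξ p a ζ p') (ha : a = .broadcast m) :
    p.StartsBroadcast := by
  induction ht with
  | broadcast _ => trivial
  | call _ _ ih => exact (not_startsBroadcast_body _ (ih ha)).elim
  | choiceLeft _ ih => exact .inl (ih ha)
  | choiceRight _ ih => exact .inr (ih ha)
  | _ => cases ha

/-- Calls are excluded by the preceding lemma and choices by `Safe`, so `p` itself is a broadcast
term. Broadcasts are kept apart from `Safe.post` because only they may change `u`. -/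
theorem Safe.post_broadcast {ζ : Valuation IP DATA} {p p' : Seq IP DATA} {m : Msg IP DATA}
    (ht : SeqTrans ξ p (.broadcast m) ζ p') (h : Safe ip A u ξ p) :
    (∃ osn, InitCast ip u osn p m ∧ Safe ip A osn ζ p') ∨
      (ForwardCast ip A u ξ p m ∧ Safe ip A u ζ p') := by
  have hb := ht.startsBroadcast rfl
  cases p with
  | broadcast ms p =>
    cases ht with
    | broadcast hm => exact h.2 m hm
  | choice p q => exact (h.1 hb).elim
  | _ => exact hb.elim

/-- What the invariant of the message queue guarantees about a transition. -/
def QPost (K : Msg IP DATA → Prop) (ζ : Valuation IP DATA) (p : Seq IP DATA) :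
    Act IP DATA → Prop
  | .receive m => ∀ K' : Msg IP DATA → Prop, (∀ m, K m → K' m) → K' m → QSafe K' ζ p
  | .send m => K m ∧ QSafe K ζ p
  | .tau => QSafe K ζ p
  | _ => False

theorem QSafe.post {K : Msg IP DATA → Prop} {ζ : Valuation IP DATA} {p p' : Seq IP DATA}
    {a : Act IP DATA} (ht : SeqTrans ξ p a ζ p') (h : QSafe K ξ p) : QPost K ζ p' a := by
  induction ht with
  | send hm => exact h _ hm
  | receive m => exact fun K' hK hm => h K' hK m hm
  | call hb _ ih =>
    obtain ⟨rfl, h⟩ := h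
    obtain ⟨ms, h1, h2⟩ := h _ hb
    exact ih (QSafe.body_qmsg h1 h2)
  | choiceLeft _ ih => exact ih h.1
  | choiceRight _ ih => exact ih h.2
  | guard hφ => exact h _ hφ
  | _ => exact h.elim

end Invariant

/-! ### Transitions of networks, node by node -/

section Network

variable {IP DATA : Type}

/-- The addresses at which `m` arrives in a transition with label `a`. -/
def Label.ArrivesAt (a : Label IP DATA) (m : Msg IP DATA) (ip : IP) : Prop :=
  match a with
  | .starcast _ R m' => m' = m ∧ ip ∈ R
  | .arrive H _ m' => m' = m ∧ ip ∈ H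
  | _ => False

/-- The actions of a process by which a message is cast. -/
def Act.Casts (m : Msg IP DATA) : Act IP DATA → Prop
  | .broadcast m' => m' = m
  | .groupcast _ m' => m' = m
  | .unicast _ m' => m' = m
  | _ => False

/-- The actions of a process that involve no message between nodes. -/
def Act.IsInternal : Act IP DATA → Prop
  | .failedUnicast _ _ => True
  | .deliver _ => True
  | .tau => True
  | _ => False

/-- Node `n` becomes `n'` by casting `m`. -/
def Node.CastStep (n : Node IP DATA) (m : Msg IP DATA) (n' : Node IP DATA) : Prop :=
  n'.ip = n.ip ∧ ∃ b, Act.Casts m b ∧ ParTrans n.proc b n'.proc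

/-- Node `n` becomes `n'`, without casting, in a transition labelled `a` of the network. -/
def Node.QuietStep (n : Node IP DATA) (a : Label IP DATA) (n' : Node IP DATA) : Prop :=
  n'.ip = n.ip ∧ (n'.proc = n.proc ∨
    (∃ m, a.ArrivesAt m n.ip ∧ ParTrans n.proc (.receive m) n'.proc) ∨
    ∃ b : Act IP DATA, b.IsInternal ∧ ParTrans n.proc b n'.proc)

/-- Node `n` becomes `n'` in a transition labelled `a` of the network. -/
def Node.Step (a : Label IP DATA) (n n' : Node IP DATA) : Prop :=
  n.QuietStep a n' ∨ ∃ R m, a = .starcast n.ip R m ∧ n.CastStep m n'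

theorem Node.QuietStep.refl (n : Node IP DATA) (a : Label IP DATA) : n.QuietStep a n :=
  ⟨rfl, .inl rfl⟩

theorem Node.QuietStep.mono {n n' : Node IP DATA} {a b : Label IP DATA} (h : n.QuietStep a n')
    (hab : ∀ m ip, a.ArrivesAt m ip → b.ArrivesAt m ip) : n.QuietStep b n' := by
  obtain ⟨h1, h2 | ⟨m, h2, h3⟩ | h2⟩ := h
  · exact ⟨h1, .inl h2⟩
  · exact ⟨h1, .inr (.inl ⟨m, hab _ _ h2, h3⟩)⟩
  · exact ⟨h1, .inr (.inr h2)⟩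

theorem Node.Step.mono_arrive {n n' : Node IP DATA} {H K : Set IP} {m : Msg IP DATA}
    {b : Label IP DATA} (h : Node.Step (.arrive H K m) n n')
    (hab : ∀ ip ∈ H, b.ArrivesAt m ip) : Node.Step b n n' := by
  obtain h | ⟨_, _, h, _⟩ := h
  · refine .inl (h.mono ?_)
    rintro m' ip ⟨rfl, hip⟩
    exact hab ip hip
  · cases h

theorem forall₂_step_refl (l : List (Node IP DATA)) (a : Label IP DATA) :
    List.Forall₂ (Node.Step a) l l :=
  List.forall₂_same.2 fun n _ => .inl (.refl n a)

/-- Transitions keep the tree of nodes, so the node lists correspond position by position. Changes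
of range are invisible to `Node.Step`, and arrivals match the range of the cast because `H ⊆ R`. -/
theorem PNetTrans.forall₂_step {M M' : PNet IP DATA} {a : Label IP DATA}
    (h : PNetTrans M a M') : List.Forall₂ (Node.Step a) M.nodes M'.nodes := by
  induction h with
  | broadcast h => exact .cons (.inr ⟨_, _, rfl, rfl, .broadcast _, rfl, h⟩) .nil
  | groupcast h => exact .cons (.inr ⟨_, _, rfl, rfl, .groupcast _ _, rfl, h⟩) .nil
  | unicast h _ => exact .cons (.inr ⟨_, _, rfl, rfl, .unicast _ _, rfl, h⟩) .nil
  | failedUnicast h _ =>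
    exact .cons (.inl ⟨rfl, .inr (.inr ⟨.failedUnicast _ _, trivial, h⟩)⟩) .nil
  | deliver h => exact .cons (.inl ⟨rfl, .inr (.inr ⟨.deliver _, trivial, h⟩)⟩) .nil
  | tau h => exact .cons (.inl ⟨rfl, .inr (.inr ⟨.tau, trivial, h⟩)⟩) .nil
  | receive h => exact .cons (.inl ⟨rfl, .inr (.inl ⟨_, ⟨rfl, rfl⟩, h⟩)⟩) .nil
  | castLeft _ _ hH _ ih1 ih2 =>
    exact List.rel_append ih1 (ih2.imp fun _ _ h => h.mono_arrive fun ip hip => ⟨rfl, hH hip⟩)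
  | castRight _ _ hH _ ih1 ih2 =>
    exact List.rel_append (ih1.imp fun _ _ h => h.mono_arrive fun ip hip => ⟨rfl, hH hip⟩) ih2
  | arrive _ _ ih1 ih2 =>
    exact List.rel_append (ih1.imp fun _ _ h => h.mono_arrive fun ip hip => ⟨rfl, .inl hip⟩)
      (ih2.imp fun _ _ h => h.mono_arrive fun ip hip => ⟨rfl, .inr hip⟩)
  | deliverLeft _ ih => exact List.rel_append ih (forall₂_step_refl _ _)
  | deliverRight _ ih => exact List.rel_append (forall₂_step_refl _ _) ih
  | tauLeft _ ih => exact List.rel_append ih (forall₂_step_refl _ _)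
  | tauRight _ ih => exact List.rel_append (forall₂_step_refl _ _) ih
  | connect _ _ ih1 ih2 => exact List.rel_append ih1 ih2
  | disconnect _ _ ih1 ih2 => exact List.rel_append ih1 ih2
  | _ => exact .cons (.inl ⟨rfl, .inl rfl⟩) .nil

/-- `Node.Step` only permits a node to cast; here some node with the address in the label really
does. -/
theorem PNetTrans.exists_castStep {M M' : PNet IP DATA} {a : Label IP DATA}
    (h : PNetTrans M a M') {s : IP} {R : Set IP} {m : Msg IP DATA} (ha : a = .starcast s R m) :
    ∃ n ∈ M.nodes, ∃ n' ∈ M'.nodes, n.ip = s ∧ n.CastStep m n' := by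
  induction h generalizing R with
  | broadcast h =>
    cases ha
    exact ⟨_, List.mem_singleton_self _, _, List.mem_singleton_self _, rfl, rfl, .broadcast _, rfl,
      h⟩
  | groupcast h =>
    cases ha
    exact ⟨_, List.mem_singleton_self _, _, List.mem_singleton_self _, rfl, rfl, .groupcast _ _, rfl,
      h⟩
  | unicast h _ =>
    cases ha
    exact ⟨_, List.mem_singleton_self _, _, List.mem_singleton_self _, rfl, rfl, .unicast _ _, rfl,
      h⟩
  | castLeft _ _ _ _ ih _ =>
    obtain ⟨n, hn, n', hn', h⟩ := ih ha
    exact ⟨n, List.mem_append_left _ hn, n', List.mem_append_left _ hn', h⟩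
  | castRight _ _ _ _ _ ih =>
    obtain ⟨n, hn, n', hn', h⟩ := ih ha
    exact ⟨n, List.mem_append_right _ hn, n', List.mem_append_right _ hn', h⟩
  | _ => cases ha

theorem forall₂_step_map_ip {l l' : List (Node IP DATA)} {a : Label IP DATA}
    (h : List.Forall₂ (Node.Step a) l l') : l'.map Node.ip = l.map Node.ip := by
  induction h with
  | nil => rfl
  | cons h _ ih =>
    rw [List.map_cons, List.map_cons, ih]
    obtain h | ⟨_, _, _, h⟩ := h <;> rw [h.1]

theorem forall₂_exists_of_mem {α β : Type*} {R : α → β → Prop} {l : List α} {l' : List β}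
    (h : List.Forall₂ R l l') {b : β} (hb : b ∈ l') : ∃ a ∈ l, R a b := by
  induction h with
  | nil => simp at hb
  | cons h _ ih =>
    obtain rfl | hb := List.mem_cons.1 hb
    · exact ⟨_, List.mem_cons_self, h⟩
    · obtain ⟨a, ha, h⟩ := ih hb
      exact ⟨a, List.mem_cons_of_mem _ ha, h⟩

/-! ### The invariant of the network -/

/-- The messages cast to `ip`, among others, in transitions with labels in `C`. -/
def castTo (C : Set (Label IP DATA)) (ip : IP) : Set (Msg IP DATA) :=
  {m | ∃ s R, Label.starcast s R m ∈ C ∧ ip ∈ R}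

/-- The invariant of a node. -/
def Node.Inv (n : Node IP DATA) (A : Set (Msg IP DATA)) (u : ℕ) : Prop :=
  ∃ ξ p ζ q, n.proc = .par (.seq ξ p) (.seq ζ q) ∧ Safe n.ip A u ξ p ∧
    QSafe (Trusted n.ip A u) ζ q

/-- The invariant of a network, after transitions with labels in `C`. -/
def Net.Inv (C : Set (Label IP DATA)) (N : Net IP DATA) : Prop :=
  (N.nodes.map Node.ip).Nodup ∧ ∃ u : IP → ℕ,
    (∀ n ∈ N.nodes, n.Inv (castTo C n.ip) (u n.ip)) ∧
    ∀ s R hops rid dip dsn dsk oip osn sip,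
      .starcast s R (.rreq hops rid dip dsn dsk oip osn sip) ∈ C → rid < osn ∧ osn ≤ u oip

theorem Net.IsInitial.inv {N : Net IP DATA} (h : N.IsInitial) : N.Inv ∅ := by
  refine ⟨h.1, fun _ => 0, fun n hn => ?_, fun _ _ _ _ _ _ _ _ _ _ h => h.elim⟩
  obtain ⟨ξ, ζ, h1, h2, h3, -, h4, -, h5⟩ := h.2 n hn
  refine ⟨ξ, _, ζ, _, h1, Safe.callAodv ⟨1, ∅, h2, h3, h4, Nat.zero_le _, le_rfl,
    fun _ h => h.elim⟩, rfl, fun ξ' hξ' => ⟨[], ?_, by simp⟩⟩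
  rw [bindArgs_map hξ' (by simp), h5]

theorem Node.Inv.mono {n : Node IP DATA} {A A' : Set (Msg IP DATA)} {u : ℕ} (h : n.Inv A u)
    (hA : A ⊆ A') : n.Inv A' u := by
  obtain ⟨ξ, p, ζ, q, h1, h2, h3⟩ := h
  exact ⟨ξ, p, ζ, q, h1, h2.mono hA, h3.mono fun m hm => hm.mono hA le_rfl⟩

theorem Node.Inv.quietStep {n n' : Node IP DATA} {A A' : Set (Msg IP DATA)} {u : ℕ}
    {a : Label IP DATA} (h : n.Inv A u) (hA : A ⊆ A') (hs : n.QuietStep a n')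
    (ha : ∀ m, a.ArrivesAt m n.ip → Trusted n.ip A' u m) : n'.Inv A' u := by
  obtain ⟨hip, hs⟩ := hs
  obtain ⟨ξ, p, ζ, q, h1, h2, h3⟩ := h
  have hK : ∀ m, Trusted n.ip A u m → Trusted n.ip A' u m := fun m hm => hm.mono hA le_rfl
  rw [Node.Inv, hip]
  rw [h1] at hs
  obtain hs | ⟨m, hm, hs⟩ | ⟨b, hb, hs⟩ := hs
  · exact ⟨ξ, p, ζ, q, hs, h2.mono hA, h3.mono hK⟩
  · generalize hP : n'.proc = P at hs
    cases hs with
    | left _ h => exact (h m rfl).elim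
    | right hs _ =>
      cases hs with
      | seq hs => exact ⟨_, _, _, _, rfl, h2.mono hA, h3.post hs _ hK (ha m hm)⟩
  · generalize hP : n'.proc = P at hs
    cases hs with
    | left hs _ =>
      cases hs with
      | seq hs =>
        refine ⟨_, _, _, _, rfl, ?_, h3.mono hK⟩
        have := (h2.mono hA).post hs
        cases b <;> first | exact this | exact hb.elim
    | right hs _ =>
      cases hs with
      | seq hs =>
        refine ⟨_, _, _, _, rfl, h2.mono hA, ?_⟩
        have := (h3.mono hK).post hs
        cases b <;> first | exact this | exact this.elim | exact hb.elim
    | sync hs hs' =>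
      cases hs with
      | seq hs =>
        cases hs' with
        | seq hs' =>
          -- The queue sends only trusted messages, which is what the receiving main process
          -- requires.
          obtain ⟨h4, h5⟩ := (h3.mono hK).post hs'
          exact ⟨_, _, _, _, rfl, h2.post hs _ hA h4, h5⟩

/-- The casting of `m` by the process `p`, where `p` neither initiates nor forwards a route
request. -/
def OtherCast (p : Seq IP DATA) (m : Msg IP DATA) : Prop :=
  ¬ m.IsRreq ∧ p ≠ newRreq IP DATA ∧ p ≠ forwardRreq IP DATA

theorem Node.Inv.castStep {n n' : Node IP DATA} {A : Set (Msg IP DATA)} {u : ℕ}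
    {m : Msg IP DATA} (h : n.Inv A u) (hs : n.CastStep m n') :
    ∃ ξ p, n.main = some (ξ, p) ∧
      ((OtherCast p m ∧ n'.Inv A u) ∨ (ForwardCast n.ip A u ξ p m ∧ n'.Inv A u) ∨
        ∃ osn, InitCast n.ip u osn p m ∧ n'.Inv A osn) := by
  obtain ⟨hip, b, hb, hs⟩ := hs
  obtain ⟨ξ, p, ζ, q, h1, h2, h3⟩ := h
  refine ⟨ξ, p, by simp [Node.main, h1], ?_⟩
  rw [h1] at hs
  simp only [Node.Inv, hip]
  generalize n'.proc = P at hs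
  cases hs with
  | right hs _ =>
    cases hs with
    -- The queue never casts.
    | seq hs =>
      have := h3.post hs
      cases b <;> first | exact this.elim | exact hb.elim
  | sync _ _ => exact hb.elim
  | left hs _ =>
    cases hs with
    | seq hs =>
      cases b with
      | broadcast m' =>
        obtain rfl : m' = m := hb
        obtain ⟨osn, h4, h5⟩ | ⟨h4, h5⟩ := h2.post_broadcast hs
        -- The initiation raises the ghost value from `u` to `osn`; the queued messages remain
        -- trusted.
        · exact .inr (.inr ⟨osn, h4, _, _, _, _, rfl, h5,
            h3.mono fun m hm => hm.mono subset_rfl h4.2.1.le⟩)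
        · exact .inr (.inl ⟨h4, _, _, _, _, rfl, h5, h3⟩)
      | groupcast D m' =>
        obtain rfl : m' = m := hb
        obtain ⟨h4, h5⟩ := h2.post hs
        exact .inl ⟨⟨h4, (by rintro rfl; cases hs), (by rintro rfl; cases hs)⟩,
          _, _, _, _, rfl, h5, h3⟩
      | unicast D m' =>
        obtain rfl : m' = m := hb
        obtain ⟨h4, h5⟩ := h2.post hs
        exact .inl ⟨⟨h4, (by rintro rfl; cases hs), (by rintro rfl; cases hs)⟩,
          _, _, _, _, rfl, h5, h3⟩
      | _ => exact hb.elim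

end Network

/-! ### Preservation of the network invariant -/

section Network

variable {IP DATA : Type} {C : Set (Label IP DATA)} {N N' : Net IP DATA}

theorem castTo_mono {C' : Set (Label IP DATA)} (h : C ⊆ C') (ip : IP) :
    castTo C ip ⊆ castTo C' ip :=
  fun _ ⟨s, R, h1, h2⟩ => ⟨s, R, h h1, h2⟩

/-- The part common to all kinds of casts. Only the caster's ghost value may change; every other
node moves quietly and at most receives `m`, which has just joined its history. -/
theorem Net.Inv.insert_of_cast {s : IP} {R : Set IP} {m : Msg IP DATA} {n' : Node IP DATA}
    {u u' : IP → ℕ} (hN : (N.nodes.map Node.ip).Nodup)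
    (hu : ∀ n ∈ N.nodes, n.Inv (castTo C n.ip) (u n.ip))
    (hC : ∀ s R hops rid dip dsn dsk oip osn sip,
      .starcast s R (.rreq hops rid dip dsn dsk oip osn sip) ∈ C → rid < osn ∧ osn ≤ u oip)
    (ht : PNetTrans N.inner (.starcast s R m) N'.inner) (hn' : n' ∈ N'.nodes) (hs : n'.ip = s)
    (hinv : n'.Inv (castTo C s) (u' s)) (hle : ∀ ip, u ip ≤ u' ip)
    (heq : ∀ ip, ip ≠ s → u' ip = u ip)
    (hm : ∀ hops rid dip dsn dsk oip osn sip, m = .rreq hops rid dip dsn dsk oip osn sip →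
      rid < osn ∧ osn ≤ u' oip) :
    N'.Inv (insert (.starcast s R m) C) := by
  have hsub : ∀ ip, castTo C ip ⊆ castTo (insert (.starcast s R m) C) ip :=
    castTo_mono (Set.subset_insert _ _)
  have hstep := ht.forall₂_step
  have hN' : (N'.nodes.map Node.ip).Nodup := by
    rw [Net.nodes, forall₂_step_map_ip hstep]
    exact hN
  refine ⟨hN', u', fun k' hk' => ?_, ?_⟩
  · by_cases hks : k'.ip = s
    -- Distinct addresses make the caster unique.
    · obtain rfl : k' = n' := List.inj_on_of_nodup_map hN' hk' hn' (hks.trans hs.symm)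
      rw [hks]
      exact hinv.mono (hsub s)
    · obtain ⟨k, hk, hq | ⟨_, _, hlab, hc⟩⟩ := forall₂_exists_of_mem hstep hk'
      · rw [heq _ hks, hq.1]
        refine (hu k hk).quietStep (hsub _) hq ?_
        rintro _ ⟨rfl, hR⟩ hops rid dip dsn dsk oip osn sip hmsg
        refine ⟨⟨s, R, Set.mem_insert _ _, hR⟩, ?_⟩
        rintro rfl
        rw [← heq _ (hq.1 ▸ hks)]
        exact hm _ _ _ _ _ _ _ _ hmsg
      · cases hlab
        exact (hks hc.1).elim
  · rintro s' R' hops rid dip dsn dsk oip osn sip (h | h)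
    · cases h
      exact hm _ _ _ _ _ _ _ _ rfl
    · have := hC _ _ _ _ _ _ _ _ _ _ h
      exact ⟨this.1, this.2.trans (hle _)⟩

theorem Net.Inv.cast {s : IP} {R : Set IP} {m : Msg IP DATA} (h : N.Inv C)
    (ht : PNetTrans N.inner (.starcast s R m) N'.inner) :
    N'.Inv (insert (.starcast s R m) C) ∧ ∃ n ∈ N.nodes, n.ip = s ∧ ∃ ξ p,
      n.main = some (ξ, p) ∧ (OtherCast p m ∨ (∃ u, ForwardCast s (castTo C s) u ξ p m) ∨
        ∃ u osn, InitCast s u osn p m ∧ ∀ s' R' hops rid dip dsn dsk osn' sip,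
          .starcast s' R' (.rreq hops rid dip dsn dsk s osn' sip) ∈ C → osn' ≤ u) := by
  obtain ⟨hN, u, hu, hC⟩ := h
  obtain ⟨n, hn, n', hn', rfl, hcast⟩ := ht.exists_castStep rfl
  have key := fun u' => Net.Inv.insert_of_cast (u' := u') hN hu hC ht hn' hcast.1
  obtain ⟨ξ, p, hmain, h | h | ⟨osn, h⟩⟩ := (hu n hn).castStep hcast
  · refine ⟨?_, n, hn, rfl, ξ, p, hmain, .inl h.1⟩
    refine key u h.2 (fun _ => le_rfl) (fun _ _ => rfl) ?_
    intro hops rid dip dsn dsk oip osn sip hm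
    exact (h.1.1 ⟨_, _, _, _, _, _, _, _, hm⟩).elim
  · refine ⟨?_, n, hn, rfl, ξ, p, hmain, .inr (.inl ⟨_, h.1⟩)⟩
    refine key u h.2 (fun _ => le_rfl) (fun _ _ => rfl) ?_
    obtain ⟨-, hops, rid, dip, dsn, dsk, oip, osn, sip, dsn', -, h2, rfl⟩ := h.1
    -- The handled message was cast before, so the global bounds hold for it and pass to the copy.
    obtain ⟨⟨s', R', h3, -⟩, -⟩ := h2 _ _ _ _ _ _ _ _ rfl
    intro _ _ _ _ _ _ _ _ hm
    cases hm
    exact hC _ _ _ _ _ _ _ _ _ _ h3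
  · refine ⟨?_, n, hn, rfl, ξ, p, hmain, .inr (.inr ⟨_, osn, h.1, ?_⟩)⟩
    · classical
      refine key (Function.update u n.ip osn) ?_ (fun ip => ?_)
        (fun ip hip => Function.update_of_ne hip _ _) ?_
      · rw [Function.update_self]
        exact h.2
      · by_cases hip : ip = n.ip
        · subst hip
          rw [Function.update_self]
          exact h.1.2.1.le
        · rw [Function.update_of_ne hip]
      · obtain ⟨-, -, rid, dip, dsn, dsk, hlt, rfl⟩ := h.1
        intro _ _ _ _ _ _ _ _ hm
        cases hm
        rw [Function.update_self]
        exact ⟨hlt, le_rfl⟩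
    · intro s' R' hops rid dip dsn dsk osn' sip hmem
      exact (hC _ _ _ _ _ _ _ _ _ _ hmem).2

/-- Encapsulation is essential: without a cast, only `newpkt` messages can arrive from outside, so
no RREQ message is injected into the network. -/
theorem Net.Inv.step {a : Label IP DATA} (h : N.Inv C) (hs : NetStep N a N') :
    N'.Inv (insert a C) := by
  obtain ⟨ht, ℓ, hℓ⟩ := hs
  by_cases ha : ∃ s R m, a = .starcast s R m
  · obtain ⟨s, R, m, rfl⟩ := ha
    exact (h.cast ht).1
  obtain ⟨hN, u, hu, hC⟩ := h
  have hstep := ht.forall₂_step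
  refine ⟨by rwa [Net.nodes, forall₂_step_map_ip hstep], u, fun k' hk' => ?_, ?_⟩
  · obtain ⟨k, hk, hq | ⟨R, m, hlab, -⟩⟩ := forall₂_exists_of_mem hstep hk'
    · rw [hq.1]
      refine (hu k hk).quietStep (castTo_mono (Set.subset_insert _ _) _) hq fun m hm => ?_
      cases hℓ with
      | starcast s R m => exact (ha ⟨s, R, m, rfl⟩).elim
      | newpkt ip K d dip =>
        obtain ⟨rfl, -⟩ := hm
        intro _ _ _ _ _ _ _ _ h
        cases h
      | _ => exact hm.elim
    · exact (ha ⟨_, R, m, hlab⟩).elim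
  · rintro s' R' hops rid dip dsn dsk oip osn sip (h | h)
    · exact (ha ⟨_, _, _, h.symm⟩).elim
    · exact hC _ _ _ _ _ _ _ _ _ _ h

theorem Net.Reachable.exists_inv (h : N.Reachable) : ∃ C, N.Inv C := by
  obtain ⟨N₀, h0, h⟩ := h
  induction h with
  | refl => exact ⟨_, h0.inv⟩
  | tail _ hs ih =>
    obtain ⟨C, hC⟩ := ih
    obtain ⟨ℓ, a, ha, hℓ⟩ := hs
    exact ⟨_, hC.step ⟨ha, ℓ, hℓ⟩⟩

theorem Net.Inv.lastRreqid_lt_sn (h : N.Inv C) {n : Node IP DATA} (hn : n ∈ N.nodes) :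
    ∃ ξ p sn rreqs, n.main = some (ξ, p) ∧ ξ .sn = some sn ∧ ξ .rreqs = some rreqs ∧
      BddAbove {k : ℕ | (n.ip, k) ∈ rreqs} ∧ lastRreqid rreqs n.ip < sn := by
  obtain ⟨-, u, hu, -⟩ := h
  obtain ⟨ξ, p, ζ, q, h1, h2, -⟩ := hu n hn
  obtain ⟨sn, rreqs, -, h3, h4, -, h5, h6⟩ := h2.base
  exact ⟨ξ, p, sn, rreqs, by simp [Node.main, h1], h3, h4, ⟨sn, fun k hk => (h6 k hk).le⟩,
    lastRreqid_lt h5 h6⟩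

end Network

/-! ### Route requests -/

section RouteRequests

variable {IP DATA : Type} (r : Run IP DATA)

/-- The labels of the first `i` transitions. -/
def Run.labelsBefore (i : ℕ) : Set (Label IP DATA) := r.label '' Set.Iio i

theorem Run.inv {i : ℕ} (hi : i ≤ r.length) : (r.state i).Inv (r.labelsBefore i) := by
  induction i with
  | zero => simpa [Run.labelsBefore] using r.initial.inv
  | succ i ih =>
    have h : r.labelsBefore (i + 1) = insert (r.label i) (r.labelsBefore i) := by
      rw [Run.labelsBefore, ← Order.succ_eq_add_one, Order.Iio_succ_eq_insert, Set.image_insert_eq,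
        Run.labelsBefore]
    rw [h]
    exact (ih (by omega)).step (r.step i (by omega))

/-- Under a valuation with hop count `0` the two messages have hop counts `0` and `1`. The address
`x` is needed: for empty `IP` both message expressions are always undefined and the processes
coincide. -/
theorem newRreq_ne_forwardRreq (x : IP) : newRreq IP DATA ≠ forwardRreq IP DATA := by
  intro h
  injection h with h _
  have := congrFun h fun
    | .ip | .dip | .oip | .sip => some x
    | .sn | .hops | .rreqid | .dsn | .osn => some 0
    | .rt => some fun _ => none
    | .dsk => some .unk
    | _ => none
  simp at this

variable {r}

/-- The `i`-th transition initiates a route request that is newer than all previous ones. -/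
def Run.FreshInit (r : Run IP DATA) (i : ℕ) (oip : IP) (osn : ℕ) : Prop :=
  r.Initiates i ∧ ∀ k < i, ∀ osn', r.CastsRreq k oip osn' → osn' < osn

theorem Run.CastsRreq.unique {i : ℕ} {oip oip' : IP} {osn osn' : ℕ} (h : r.CastsRreq i oip osn)
    (h' : r.CastsRreq i oip' osn') : (oip, osn) = (oip', osn') := by
  obtain ⟨-, _, _, _, _, _, _, _, _, h⟩ := h
  obtain ⟨-, _, _, _, _, _, _, _, _, h'⟩ := h'
  rw [h] at h'
  cases h'
  rfl

/-- The label names the caster, and addresses are distinct. -/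
theorem Run.eq_of_castsFrom {i : ℕ} {s s' : IP} {ξ ξ' : Valuation IP DATA} {p p' : Seq IP DATA}
    (h : r.CastsFrom i s ξ p) (h' : r.CastsFrom i s' ξ' p') : ξ = ξ' ∧ p = p' := by
  obtain ⟨hi, ⟨R, m, hl⟩, n, hn, rfl, hm⟩ := h
  obtain ⟨-, ⟨R', m', hl'⟩, n', hn', rfl, hm'⟩ := h'
  rw [hl] at hl'
  injection hl' with hip _ _
  obtain rfl := List.inj_on_of_nodup_map (r.inv hi.le).1 hn hn' hip
  rw [hm] at hm'
  simpa using hm'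

/-- The three possibilities for a cast: it initiates a route request, forwards one, or neither. -/
theorem Run.cast_cases {i : ℕ} (hi : i < r.length) {s : IP} {R : Set IP} {m : Msg IP DATA}
    (hl : r.label i = .starcast s R m) :
    ∃ ξ p, r.CastsFrom i s ξ p ∧ (OtherCast p m ∨
      (p = forwardRreq IP DATA ∧ ∃ oip osn k, r.CastsRreq i oip osn ∧ r.CastsRreq k oip osn ∧
        r.Forwards k i ∧ ∃ s' R' m', handledRreq ξ = some m' ∧ r.label k = .starcast s' R' m') ∨
      (p = newRreq IP DATA ∧ ∃ osn, r.CastsRreq i s osn ∧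
        ∀ k < i, ∀ osn', r.CastsRreq k s osn' → osn' < osn)) := by
  have ht := (r.step i hi).1
  rw [hl] at ht
  obtain ⟨-, n, hn, rfl, ξ, p, hmain, h⟩ := (r.inv hi.le).cast ht
  have hcf : r.CastsFrom i n.ip ξ p := ⟨hi, ⟨R, m, hl⟩, n, hn, rfl, hmain⟩
  refine ⟨ξ, p, hcf, ?_⟩
  obtain h | ⟨u, h⟩ | ⟨u, osn, ⟨rfl, hlt, rid, dip, dsn, dsk, -, rfl⟩, h2⟩ := h
  · exact .inl h
  · obtain ⟨rfl, hops, rid, dip, dsn, dsk, oip, osn, sip, dsn', h1, h2, rfl⟩ := h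
    obtain ⟨⟨s', R', ⟨k, hk, h3⟩, h4⟩, -⟩ := h2 _ _ _ _ _ _ _ _ rfl
    have hk : k < i := hk
    exact .inr (.inl ⟨rfl, oip, osn, k, ⟨hi, _, _, _, _, _, _, _, _, hl⟩,
      ⟨hk.trans hi, _, _, _, _, _, _, _, _, h3⟩,
      ⟨hk, n.ip, ξ, _, hcf, h1, s', R', h3, h4⟩, s', R', _, h1, h3⟩)
  · refine .inr (.inr ⟨rfl, osn, ⟨hi, _, _, _, _, _, _, _, _, hl⟩, ?_⟩)
    rintro k hk osn' ⟨-, _, _, _, _, _, _, _, _, h3⟩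
    exact (h2 _ _ _ _ _ _ _ _ _ ⟨k, hk, h3⟩).trans_lt hlt

theorem Run.Forwards.castsRreq {i j : ℕ} (h : r.Forwards i j) :
    ∃ oip osn, r.CastsRreq i oip osn ∧ r.CastsRreq j oip osn := by
  obtain ⟨hij, s, ξ, m, hcf, hm, s', R', hl, -⟩ := h
  obtain ⟨R, m', hl'⟩ := hcf.2.1
  obtain ⟨ξ', p, hcf', h⟩ := Run.cast_cases hcf.1 hl'
  obtain ⟨rfl, rfl⟩ := Run.eq_of_castsFrom hcf hcf'
  obtain h | ⟨-, oip, osn, k, h1, ⟨-, _, _, _, _, _, _, _, _, h2⟩, -, _, _, m', h3, h4⟩ |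
    ⟨h, -⟩ := h
  · exact (h.2.2 rfl).elim
  -- The earlier transmission `k` from the invariant may differ from `i`, but both carry the handled
  -- message, so the pairs agree.
  · rw [hm] at h3
    cases h3
    rw [h4] at h2
    cases h2
    exact ⟨oip, osn, ⟨hij.trans hcf.1, _, _, _, _, _, _, _, _, hl⟩, h1⟩
  · exact (newRreq_ne_forwardRreq s h.symm).elim

theorem Run.SameRouteRequest.castsRreq {i j : ℕ} (h : r.SameRouteRequest i j) (oip : IP)
    (osn : ℕ) : r.CastsRreq i oip osn ↔ r.CastsRreq j oip osn := by
  induction h with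
  | rel i j h =>
    obtain ⟨oip', osn', h1, h2⟩ := h.castsRreq
    constructor <;> intro h
    · cases h.unique h1
      exact h2
    · cases h.unique h2
      exact h1
  | refl => rfl
  | symm _ _ _ ih => exact ih.symm
  | trans _ _ _ _ _ ih1 ih2 => exact ih1.trans ih2

theorem Run.Initiates.freshInit {i : ℕ} {oip : IP} {osn : ℕ} (h : r.Initiates i)
    (hc : r.CastsRreq i oip osn) : r.FreshInit i oip osn := by
  refine ⟨h, ?_⟩
  obtain ⟨s, ξ, hcf⟩ := h
  obtain ⟨R, m, hl⟩ := hcf.2.1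
  obtain ⟨ξ', p, hcf', h⟩ := Run.cast_cases hcf.1 hl
  obtain ⟨rfl, rfl⟩ := Run.eq_of_castsFrom hcf hcf'
  obtain h | ⟨h, -⟩ | ⟨-, osn', h1, h2⟩ := h
  · exact (h.2.1 rfl).elim
  · exact (newRreq_ne_forwardRreq s h).elim
  · cases hc.unique h1
    exact h2

theorem Run.Initiates.eq {i j : ℕ} {oip : IP} {osn : ℕ} (hi : r.Initiates i)
    (hj : r.Initiates j) (hci : r.CastsRreq i oip osn) (hcj : r.CastsRreq j oip osn) : i = j := by
  obtain h | h | h := lt_trichotomy i j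
  · exact (lt_irrefl _ ((hj.freshInit hcj).2 i h osn hci)).elim
  · exact h
  · exact (lt_irrefl _ ((hi.freshInit hci).2 j h osn hcj)).elim

/-- Descent in time: a RREQ cast is either an initiation or forwards a strictly earlier cast with
the same pair. -/
theorem Run.CastsRreq.exists_initiates {j : ℕ} {oip : IP} {osn : ℕ}
    (h : r.CastsRreq j oip osn) :
    ∃ i, r.Initiates i ∧ r.CastsRreq i oip osn ∧ r.SameRouteRequest i j := by
  induction j using Nat.strong_induction_on with
  | _ j ih =>
    obtain ⟨hj, s, R, hops, rid, dip, dsn, dsk, sip, hl⟩ := id h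
    obtain ⟨ξ, p, hcf, h1 | ⟨-, oip', osn', k, h1, h2, h3, -⟩ | ⟨rfl, -⟩⟩ :=
      Run.cast_cases hj hl
    · exact (h1.1 ⟨_, _, _, _, _, _, _, _, rfl⟩).elim
    · cases h.unique h1
      obtain ⟨i, hi1, hi2, hi3⟩ := ih k h3.1 h2
      exact ⟨i, hi1, hi2, hi3.trans _ _ _ (.rel _ _ h3)⟩
    · exact ⟨j, ⟨s, ξ, hcf⟩, h, .refl _⟩

theorem Run.sameRouteRequest_iff {i j : ℕ} {oip oip' : IP} {osn osn' : ℕ}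
    (hi : r.CastsRreq i oip osn) (hj : r.CastsRreq j oip' osn') :
    r.SameRouteRequest i j ↔ (oip, osn) = (oip', osn') := by
  constructor
  · intro h
    exact ((h.castsRreq oip osn).1 hi).unique hj
  · intro h
    cases h
    obtain ⟨i', hi1, hi2, hi3⟩ := hi.exists_initiates
    obtain ⟨j', hj1, hj2, hj3⟩ := hj.exists_initiates
    cases hi1.eq hj1 hi2 hj2
    exact hi3.symm.trans _ _ _ hj3

end RouteRequests

end AODV

theorem mainTheorem11 (IP DATA : Type) :
    (∀ N : AODV.Net IP DATA, N.Reachable → ∀ n ∈ N.nodes,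
      ∃ ξ p sn rreqs, n.main = some (ξ, p) ∧ ξ .sn = some sn ∧ ξ .rreqs = some rreqs ∧
        BddAbove {k : ℕ | (n.ip, k) ∈ rreqs} ∧ AODV.lastRreqid rreqs n.ip < sn) ∧
    (∀ r : AODV.Run IP DATA,
      (∀ i j oip osn oip' osn', r.CastsRreq i oip osn → r.CastsRreq j oip' osn' →
        (r.SameRouteRequest i j ↔ (oip, osn) = (oip', osn'))) ∧
      (∀ i j oip osn, r.Initiates i → r.Initiates j →
        r.CastsRreq i oip osn → r.CastsRreq j oip osn → i = j)) := by
  exact ⟨fun N hN n hn => hN.exists_inv.choose_spec.lastRreqid_lt_sn hn, fun r =>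
    ⟨fun _ _ _ _ _ _ hi hj => AODV.Run.sameRouteRequest_iff hi hj,
      fun _ _ _ _ hi hj hci hcj => hi.eq hj hci hcj⟩⟩
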